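/- Let $K$ be a field; all tensor products are over $K$. Let $A$ be a quasitriangular quasi-Hopf algebra over $K$, that is, an associative unital $K$-algebra with the following structure. (a) Algebra homomorphisms $\Delta: A \to A\otimes A$, $a \mapsto a_{(1)}\otimes a_{(2)}$, and $\varepsilon: A\to K$, and an invertible element $\Phi=\sum_i X_i\otimes Y_i\otimes Z_i\in A\otimes A\otimes A$ with inverse $\Phi^{-1}=\sum_j \bar X_j\otimes\bar Y_j\otimes\bar Z_j$, such that for all $a\in A$ $$(\mathrm{id}\otimes\Delta)\Delta(a)\,\Phi=\Phi\,(\Delta\otimes\mathrm{id})\Delta(a),\qquad (\varepsilon\otimes\mathrm{id})\Delta(a)=a=(\mathrm{id}\otimes\varepsilon)\Delta(a),$$ $$(\mathrm{id}\otimes\mathrm{id}\otimes\Delta)(\Phi)\,(\Delta\otimes\mathrm{id}\otimes\mathrm{id})(\Phi)=(1\otimes\Phi)\,(\mathrm{id}\otimes\Delta\otimes\mathrm{id})(\Phi)\,(\Phi\otimes1),\qquad (\mathrm{id}\otimes\varepsilon\otimes\mathrm{id})(\Phi)=1\otimes1.$$ (b) An algebra anti-automorphism $S:A\to A$ and elements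 $\alpha,\beta\in A$ such that $S(a_{(1)})\,\alpha\, a_{(2)}=\varepsilon(a)\alpha$ and $a_{(1)}\,\beta\, S(a_{(2)})=\varepsilon(a)\beta$ for all $a\in A$, and $$\sum_i X_i\,\beta\, S(Y_i)\,\alpha\, Z_i=1=\sum_j S(\bar X_j)\,\alpha\,\bar Y_j\,\beta\, S(\bar Z_j).$$ (c) An invertible element $R=\sum_l s_l\otimes t_l\in A\otimes A$ (the R-matrix) such that $(a_{(2)}\otimes a_{(1)})R=R\,\Delta(a)$ for all $a\in A$, and $$(\Delta\otimes\mathrm{id})(R)=\sum_{i,j,k,l,q} Y_i s_l\bar X_jX_k\otimes Z_i\bar Z_js_qY_k\otimes X_it_l\bar Y_jt_qZ_k,$$ $$(\mathrm{id}\otimes\Delta)(R)=\sum_{i,j,k,l,q}\bar Z_is_lY_js_q\bar X_k\otimes\bar X_iX_jt_q\bar Y_k\otimes\bar Y_it_lZ_j\bar Z_k.$$ For $T\in A\otimes A$ let $T'$ denote its image under the interchange of the two tensor factors. Put $$\gamma:=\sum_{i,j}S(\bar X_iY_j)\,\alpha\,\bar Y_iZ_{j(1)}\otimes S(X_j)\,\alpha\,\bar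 Z_iZ_{j(2)},\qquad F:=\sum_i\bigl(S(\bar X_{i(2)})\otimes S(\bar X_{i(1)})\bigr)\,\gamma\,\Delta\bigl(\bar Y_i\,\beta\, S(\bar Z_i)\bigr),$$ and define the Drinfel'd element $$u:=\sum_{i,l}S\bigl(\bar Y_i\,\beta\, S(\bar Z_i)\bigr)\,S(t_l)\,\alpha\, s_l\,\bar X_i .$$ **Proposition.** The elements $u\in A$ and $F\in A\otimes A$ are invertible. Moreover: 1. $\varepsilon(u)=1$; 2. $S^2(a)=u\,a\,u^{-1}$ for all $a\in A$; 3. $\Delta(u)=F^{-1}\,\bigl((S\otimes S)(F')\bigr)\,(u\otimes u)\,(R'R)^{-1}$. -/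

import Mathlib

open scoped TensorProduct

noncomputable section

namespace QuasiHopf

universe u v

section Tensors

variable (K : Type u) {A : Type v} [Field K] [Ring A] [Algebra K A]

variable (A) in
/-- The interchange `x ⊗ y ↦ y ⊗ x` of the two tensor factors of `A ⊗ A`. -/
def swap : A ⊗[K] A ≃ₐ[K] A ⊗[K] A := Algebra.TensorProduct.comm K A A

variable (A) in
/-- `x ⊗ y ⊗ z ↦ x ⊗ z ⊗ y`. -/
def perm132 : A ⊗[K] (A ⊗[K] A) →ₐ[K] A ⊗[K] (A ⊗[K] A) :=
  Algebra.TensorProduct.map (AlgHom.id K A) (swap K A).toAlgHom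

variable (A) in
/-- `x ⊗ y ⊗ z ↦ y ⊗ x ⊗ z`. -/
def permYXZ : A ⊗[K] (A ⊗[K] A) →ₐ[K] A ⊗[K] (A ⊗[K] A) :=
  (Algebra.TensorProduct.leftComm K A A A).toAlgHom

variable (A) in
/-- `x ⊗ y ⊗ z ↦ y ⊗ z ⊗ x`. -/
def permYZX : A ⊗[K] (A ⊗[K] A) →ₐ[K] A ⊗[K] (A ⊗[K] A) :=
  (perm132 K A).comp (permYXZ K A)

variable (A) in
/-- `x ⊗ y ⊗ z ↦ z ⊗ x ⊗ y`. -/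
def permZXY : A ⊗[K] (A ⊗[K] A) →ₐ[K] A ⊗[K] (A ⊗[K] A) :=
  (permYXZ K A).comp (perm132 K A)

variable (A) in
/-- `s ⊗ t ↦ s ⊗ t ⊗ 1`. -/
def leg12 : A ⊗[K] A →ₐ[K] A ⊗[K] (A ⊗[K] A) :=
  Algebra.TensorProduct.map (AlgHom.id K A) Algebra.TensorProduct.includeLeft

variable (A) in
/-- `s ⊗ t ↦ s ⊗ 1 ⊗ t`. -/
def leg13 : A ⊗[K] A →ₐ[K] A ⊗[K] (A ⊗[K] A) :=
  Algebra.TensorProduct.map (AlgHom.id K A) Algebra.TensorProduct.includeRight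

variable (A) in
/-- `s ⊗ t ↦ 1 ⊗ s ⊗ t`. -/
def leg23 : A ⊗[K] A →ₐ[K] A ⊗[K] (A ⊗[K] A) :=
  Algebra.TensorProduct.includeRight

variable (A) in
/-- `(x ⊗ y) ⊗ z ↦ x ⊗ (y ⊗ z)`. -/
def assoc : (A ⊗[K] A) ⊗[K] A ≃ₐ[K] A ⊗[K] (A ⊗[K] A) :=
  Algebra.TensorProduct.assoc K K K A A A

/-! The third tensor power of `A` is written `A ⊗ (A ⊗ A)`, the fourth `(A ⊗ A) ⊗ (A ⊗ A)`. -/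

variable (A) in
/-- `T ↦ T ⊗ 1` from the third to the fourth tensor power of `A`. -/
def leg123 : A ⊗[K] (A ⊗[K] A) →ₐ[K] (A ⊗[K] A) ⊗[K] (A ⊗[K] A) :=
  (Algebra.TensorProduct.map (AlgHom.id K (A ⊗[K] A))
    Algebra.TensorProduct.includeLeft).comp (assoc K A).symm.toAlgHom

variable (A) in
/-- `T ↦ 1 ⊗ T` from the third to the fourth tensor power of `A`. -/
def leg234 : A ⊗[K] (A ⊗[K] A) →ₐ[K] (A ⊗[K] A) ⊗[K] (A ⊗[K] A) :=
  Algebra.TensorProduct.map Algebra.TensorProduct.includeRight (AlgHom.id K (A ⊗[K] A))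

variable (A) in
/-- `(x ⊗ z) ⊗ (y ⊗ w) ↦ (x ⊗ y) ⊗ (w ⊗ z)`. -/
def moveSecond : (A ⊗[K] A) ⊗[K] (A ⊗[K] A) →ₐ[K] (A ⊗[K] A) ⊗[K] (A ⊗[K] A) :=
  (Algebra.TensorProduct.map (AlgHom.id K (A ⊗[K] A)) (swap K A).toAlgHom).comp
    (Algebra.TensorProduct.tensorTensorTensorComm K K K K A A A A).toAlgHom

variable {K}

/-- `id ⊗ Δ` on `A ⊗ A`. -/
def idDelta (Δ : A →ₐ[K] A ⊗[K] A) : A ⊗[K] A →ₐ[K] A ⊗[K] (A ⊗[K] A) :=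
  Algebra.TensorProduct.map (AlgHom.id K A) Δ

/-- `Δ ⊗ id` on `A ⊗ A`. -/
def deltaId (Δ : A →ₐ[K] A ⊗[K] A) : A ⊗[K] A →ₐ[K] A ⊗[K] (A ⊗[K] A) :=
  (assoc K A).toAlgHom.comp (Algebra.TensorProduct.map Δ (AlgHom.id K A))

/-- `id ⊗ id ⊗ Δ` on `A ⊗ A ⊗ A`. -/
def idIdDelta (Δ : A →ₐ[K] A ⊗[K] A) :
    A ⊗[K] (A ⊗[K] A) →ₐ[K] (A ⊗[K] A) ⊗[K] (A ⊗[K] A) :=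
  (Algebra.TensorProduct.map (AlgHom.id K (A ⊗[K] A)) Δ).comp (assoc K A).symm.toAlgHom

/-- `id ⊗ Δ ⊗ id` on `A ⊗ A ⊗ A`; it is computed as
`x ⊗ y ⊗ z ↦ (x ⊗ z) ⊗ (y₁ ⊗ y₂) ↦ (x ⊗ y₁) ⊗ (y₂ ⊗ z)`. -/
def idDeltaId (Δ : A →ₐ[K] A ⊗[K] A) :
    A ⊗[K] (A ⊗[K] A) →ₐ[K] (A ⊗[K] A) ⊗[K] (A ⊗[K] A) :=
  (moveSecond K A).comp ((idIdDelta Δ).comp (perm132 K A))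

/-- `Δ ⊗ id ⊗ id` on `A ⊗ A ⊗ A`. -/
def deltaIdId (Δ : A →ₐ[K] A ⊗[K] A) :
    A ⊗[K] (A ⊗[K] A) →ₐ[K] (A ⊗[K] A) ⊗[K] (A ⊗[K] A) :=
  Algebra.TensorProduct.map Δ (AlgHom.id K (A ⊗[K] A))

/-- `ε ⊗ id`, as a map `A ⊗ A → A`. -/
def epsId (ε : A →ₐ[K] K) : A ⊗[K] A →ₐ[K] A :=
  (Algebra.TensorProduct.lid K A).toAlgHom.comp
    (Algebra.TensorProduct.map ε (AlgHom.id K A))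

/-- `id ⊗ ε`, as a map `A ⊗ A → A`. -/
def idEps (ε : A →ₐ[K] K) : A ⊗[K] A →ₐ[K] A :=
  (Algebra.TensorProduct.rid K K A).toAlgHom.comp
    (Algebra.TensorProduct.map (AlgHom.id K A) ε)

/-- `id ⊗ ε ⊗ id`, as a map `A ⊗ A ⊗ A → A ⊗ A`. -/
def idEpsId (ε : A →ₐ[K] K) : A ⊗[K] (A ⊗[K] A) →ₐ[K] A ⊗[K] A :=
  Algebra.TensorProduct.map (AlgHom.id K A) (epsId ε)

/-- `x ⊗ y ↦ S(x) α y`. -/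
def evMap (S : A ≃ₗ[K] A) (α : A) : A ⊗[K] A →ₗ[K] A :=
  LinearMap.mul' K A ∘ₗ TensorProduct.map S.toLinearMap (LinearMap.mulLeft K α)

/-- `x ⊗ y ↦ x β S(y)`. -/
def coevMap (S : A ≃ₗ[K] A) (β : A) : A ⊗[K] A →ₗ[K] A :=
  LinearMap.mul' K A ∘ₗ TensorProduct.map (LinearMap.mulRight K β) S.toLinearMap

/-- `x ⊗ y ⊗ z ↦ x β S(y) α z`. -/
def dualMap₁ (S : A ≃ₗ[K] A) (α β : A) : A ⊗[K] (A ⊗[K] A) →ₗ[K] A :=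
  LinearMap.mul' K A ∘ₗ TensorProduct.map (LinearMap.mulRight K β) (evMap S α)

/-- `x ⊗ y ⊗ z ↦ S(x) α y β S(z)`. -/
def dualMap₂ (S : A ≃ₗ[K] A) (α β : A) : A ⊗[K] (A ⊗[K] A) →ₗ[K] A :=
  LinearMap.mul' K A ∘ₗ
    TensorProduct.map (LinearMap.mulRight K α ∘ₗ S.toLinearMap) (coevMap S β)

/-- `x ⊗ y ⊗ z ⊗ w ↦ S(y) α z ⊗ S(x) α w`. -/
def gammaMap (S : A ≃ₗ[K] A) (α : A) : (A ⊗[K] A) ⊗[K] (A ⊗[K] A) →ₗ[K] A ⊗[K] A :=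
  TensorProduct.map (evMap S α) (evMap S α) ∘ₗ
    (TensorProduct.tensorTensorTensorComm K A A A A).toLinearMap ∘ₗ
    TensorProduct.map (swap K A).toLinearMap LinearMap.id

section PureTensors

/-! The values of these maps on pure tensors. -/

variable (x y z w : A)

theorem assoc_tmul : assoc K A ((x ⊗ₜ y) ⊗ₜ z) = x ⊗ₜ (y ⊗ₜ z) := rfl

theorem swap_tmul : swap K A (x ⊗ₜ y) = y ⊗ₜ x := rfl

theorem perm132_tmul : perm132 K A (x ⊗ₜ (y ⊗ₜ z)) = x ⊗ₜ (z ⊗ₜ y) := rfl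

theorem permYXZ_tmul : permYXZ K A (x ⊗ₜ (y ⊗ₜ z)) = y ⊗ₜ (x ⊗ₜ z) := rfl

theorem permYZX_tmul : permYZX K A (x ⊗ₜ (y ⊗ₜ z)) = y ⊗ₜ (z ⊗ₜ x) := rfl

theorem permZXY_tmul : permZXY K A (x ⊗ₜ (y ⊗ₜ z)) = z ⊗ₜ (x ⊗ₜ y) := rfl

theorem leg12_tmul : leg12 K A (x ⊗ₜ y) = x ⊗ₜ (y ⊗ₜ 1) := rfl

theorem leg13_tmul : leg13 K A (x ⊗ₜ y) = x ⊗ₜ (1 ⊗ₜ y) := rfl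

theorem leg23_tmul : leg23 K A (x ⊗ₜ y) = 1 ⊗ₜ (x ⊗ₜ y) := rfl

theorem leg123_tmul : leg123 K A (x ⊗ₜ (y ⊗ₜ z)) = (x ⊗ₜ y) ⊗ₜ (z ⊗ₜ 1) := rfl

theorem leg234_tmul : leg234 K A (x ⊗ₜ (y ⊗ₜ z)) = (1 ⊗ₜ x) ⊗ₜ (y ⊗ₜ z) := rfl

theorem moveSecond_tmul : moveSecond K A ((x ⊗ₜ z) ⊗ₜ (y ⊗ₜ w)) = (x ⊗ₜ y) ⊗ₜ (w ⊗ₜ z) := rfl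

variable (Δ : A →ₐ[K] A ⊗[K] A)

theorem idDelta_tmul : idDelta Δ (x ⊗ₜ y) = x ⊗ₜ Δ y := rfl

theorem deltaId_tmul : deltaId Δ (x ⊗ₜ y) = assoc K A (Δ x ⊗ₜ y) := rfl

theorem idIdDelta_tmul : idIdDelta Δ (x ⊗ₜ (y ⊗ₜ z)) = (x ⊗ₜ y) ⊗ₜ Δ z := rfl

theorem idDeltaId_tmul : idDeltaId Δ (x ⊗ₜ (y ⊗ₜ z)) = moveSecond K A ((x ⊗ₜ z) ⊗ₜ Δ y) := rfl

theorem deltaIdId_tmul : deltaIdId Δ (x ⊗ₜ (y ⊗ₜ z)) = Δ x ⊗ₜ (y ⊗ₜ z) := rfl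

variable (ε : A →ₐ[K] K)

theorem epsId_tmul : epsId ε (x ⊗ₜ y) = ε x • y := rfl

theorem idEps_tmul : idEps ε (x ⊗ₜ y) = ε y • x := rfl

theorem idEpsId_tmul : idEpsId ε (x ⊗ₜ (y ⊗ₜ z)) = x ⊗ₜ (ε y • z) := rfl

variable (S : A ≃ₗ[K] A) (α β : A)

theorem evMap_tmul : evMap S α (x ⊗ₜ y) = S x * α * y := (mul_assoc _ _ _).symm

theorem coevMap_tmul : coevMap S β (x ⊗ₜ y) = x * β * S y := rfl

theorem dualMap₁_tmul : dualMap₁ S α β (x ⊗ₜ (y ⊗ₜ z)) = x * β * S y * α * z := by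
  change x * β * (S y * (α * z)) = _
  simp only [mul_assoc]

theorem dualMap₂_tmul : dualMap₂ S α β (x ⊗ₜ (y ⊗ₜ z)) = S x * α * y * β * S z := by
  change S x * α * (y * β * S z) = _
  simp only [mul_assoc]

theorem gammaMap_tmul :
    gammaMap S α ((x ⊗ₜ y) ⊗ₜ (z ⊗ₜ w)) = (S y * α * z) ⊗ₜ (S x * α * w) := by
  rw [← evMap_tmul, ← evMap_tmul]
  rfl

end PureTensors

end Tensors

/-- A quasi-bialgebra structure `(Δ, ε, Φ)` on the associative unital `K`-algebra `A`. -/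
structure QuasiBialgebra (K : Type u) (A : Type v) [Field K] [Ring A] [Algebra K A] where
  /-- the coproduct -/
  Δ : A →ₐ[K] A ⊗[K] A
  /-- the counit -/
  ε : A →ₐ[K] K
  /-- the (invertible) associator -/
  Φ : (A ⊗[K] (A ⊗[K] A))ˣ
  /-- `(id ⊗ Δ)Δ(a) Φ = Φ (Δ ⊗ id)Δ(a)` -/
  quasi_coassoc : ∀ a : A, idDelta Δ (Δ a) * (Φ : A ⊗[K] (A ⊗[K] A)) = Φ * deltaId Δ (Δ a)
  /-- `(id ⊗ id ⊗ Δ)(Φ) (Δ ⊗ id ⊗ id)(Φ) = (1 ⊗ Φ) (id ⊗ Δ ⊗ id)(Φ) (Φ ⊗ 1)` -/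
  pentagon : idIdDelta Δ (Φ : A ⊗[K] (A ⊗[K] A)) * deltaIdId Δ (Φ : A ⊗[K] (A ⊗[K] A)) =
    leg234 K A Φ * idDeltaId Δ (Φ : A ⊗[K] (A ⊗[K] A)) * leg123 K A Φ
  /-- `(ε ⊗ id)Δ(a) = a` -/
  counit_left : ∀ a : A, epsId ε (Δ a) = a
  /-- `(id ⊗ ε)Δ(a) = a` -/
  counit_right : ∀ a : A, idEps ε (Δ a) = a
  /-- `(id ⊗ ε ⊗ id)(Φ) = 1 ⊗ 1` -/
  counit_associator : idEpsId ε (Φ : A ⊗[K] (A ⊗[K] A)) = 1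

/-- A quasi-Hopf algebra structure on `A`: a quasi-bialgebra structure together with an algebra
anti-automorphism `S`, an evaluation element `α` and a coevaluation element `β`. -/
structure QuasiHopfAlgebra (K : Type u) (A : Type v) [Field K] [Ring A] [Algebra K A] extends
    QuasiBialgebra K A where
  /-- the antipode -/
  S : A ≃ₗ[K] A
  S_one : S 1 = 1
  S_mul : ∀ a b : A, S (a * b) = S b * S a
  /-- the evaluation element -/
  α : A
  /-- the coevaluation element -/
  β : A
  /-- `S(a₁) α a₂ = ε(a) α` -/
  antipode_left : ∀ a : A, evMap S α (Δ a) = ε a • α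
  /-- `a₁ β S(a₂) = ε(a) β` -/
  antipode_right : ∀ a : A, coevMap S β (Δ a) = ε a • β
  /-- `∑ X β S(Y) α Z = 1`, where `Φ = ∑ X ⊗ Y ⊗ Z` -/
  duality₁ : dualMap₁ S α β (Φ : A ⊗[K] (A ⊗[K] A)) = 1
  /-- `∑ S(X) α Y β S(Z) = 1`, where `Φ⁻¹ = ∑ X ⊗ Y ⊗ Z` -/
  duality₂ : dualMap₂ S α β ((Φ⁻¹ : (A ⊗[K] (A ⊗[K] A))ˣ) : A ⊗[K] (A ⊗[K] A)) = 1

/-- A quasitriangular quasi-Hopf algebra structure on `A`: a quasi-Hopf algebra structure together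
with an R-matrix `R`. -/
structure QuasitriangularQuasiHopfAlgebra (K : Type u) (A : Type v) [Field K] [Ring A]
    [Algebra K A] extends QuasiHopfAlgebra K A where
  /-- the (invertible) R-matrix -/
  R : (A ⊗[K] A)ˣ
  /-- `Δᶜᵒᵖ(a) R = R Δ(a)` -/
  quasi_cocomm : ∀ a : A, swap K A (Δ a) * (R : A ⊗[K] A) = R * Δ a
  /-- The left hexagon axiom. With `Φ = ∑ X ⊗ Y ⊗ Z`, `Φ⁻¹ = ∑ X' ⊗ Y' ⊗ Z'`, `R = ∑ s ⊗ t`, the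
  factors are `Y ⊗ Z ⊗ X`, `s ⊗ 1 ⊗ t`, `X' ⊗ Z' ⊗ Y'`, `1 ⊗ s ⊗ t`, `X ⊗ Y ⊗ Z`. -/
  hexagon_left : deltaId Δ (R : A ⊗[K] A) =
    permYZX K A Φ * leg13 K A R *
      perm132 K A ((Φ⁻¹ : (A ⊗[K] (A ⊗[K] A))ˣ) : A ⊗[K] (A ⊗[K] A)) *
      leg23 K A R * (Φ : A ⊗[K] (A ⊗[K] A))
  /-- The right hexagon axiom. With the same notation, the factors are `Z' ⊗ X' ⊗ Y'`,
  `s ⊗ 1 ⊗ t`, `Y ⊗ X ⊗ Z`, `s ⊗ t ⊗ 1`, `X' ⊗ Y' ⊗ Z'`. -/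
  hexagon_right : idDelta Δ (R : A ⊗[K] A) =
    permZXY K A ((Φ⁻¹ : (A ⊗[K] (A ⊗[K] A))ˣ) : A ⊗[K] (A ⊗[K] A)) *
      leg13 K A R * permYXZ K A Φ * leg12 K A R *
      ((Φ⁻¹ : (A ⊗[K] (A ⊗[K] A))ˣ) : A ⊗[K] (A ⊗[K] A))

variable {K : Type u} {A : Type v} [Field K] [Ring A] [Algebra K A]

namespace QuasiHopfAlgebra

variable (H : QuasiHopfAlgebra K A)

/-- The inverse of the associator, as an element of `A ⊗ A ⊗ A`. -/
def Φinv : A ⊗[K] (A ⊗[K] A) := ((H.Φ⁻¹ : (A ⊗[K] (A ⊗[K] A))ˣ) : A ⊗[K] (A ⊗[K] A))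

/-- `S ⊗ S` on `A ⊗ A`. -/
def SS : A ⊗[K] A →ₗ[K] A ⊗[K] A := TensorProduct.map H.S.toLinearMap H.S.toLinearMap

/-- With `Φ = ∑ⱼ Xⱼ ⊗ Yⱼ ⊗ Zⱼ` and `Φ⁻¹ = ∑ᵢ X'ᵢ ⊗ Y'ᵢ ⊗ Z'ᵢ`, this is
`γ = ∑ᵢⱼ S(X'ᵢ Yⱼ) α Y'ᵢ Zⱼ₍₁₎ ⊗ S(Xⱼ) α Z'ᵢ Zⱼ₍₂₎`; note that
`(1 ⊗ Φ⁻¹) (id ⊗ id ⊗ Δ)(Φ) = ∑ᵢⱼ Xⱼ ⊗ X'ᵢ Yⱼ ⊗ Y'ᵢ Zⱼ₍₁₎ ⊗ Z'ᵢ Zⱼ₍₂₎`. -/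
def γ : A ⊗[K] A :=
  gammaMap H.S H.α (leg234 K A H.Φinv * idIdDelta H.Δ (H.Φ : A ⊗[K] (A ⊗[K] A)))

/-- `x ⊗ y ⊗ z ↦ (S(x₍₂₎) ⊗ S(x₍₁₎)) γ Δ(y β S(z))`. -/
def FMap : A ⊗[K] (A ⊗[K] A) →ₗ[K] A ⊗[K] A :=
  LinearMap.mul' K (A ⊗[K] A) ∘ₗ
    TensorProduct.map
      (LinearMap.mulRight K H.γ ∘ₗ H.SS ∘ₗ (swap K A).toLinearMap ∘ₗ H.Δ.toLinearMap)
      (H.Δ.toLinearMap ∘ₗ coevMap H.S H.β)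

/-- `F = ∑ (S(X'₍₂₎) ⊗ S(X'₍₁₎)) γ Δ(Y' β S(Z'))`, where `Φ⁻¹ = ∑ X' ⊗ Y' ⊗ Z'`. -/
def F : A ⊗[K] A := H.FMap H.Φinv

theorem FMap_tmul (x y z : A) : H.FMap (x ⊗ₜ (y ⊗ₜ z)) =
    H.SS (swap K A (H.Δ x)) * H.γ * H.Δ (y * H.β * H.S z) := rfl

end QuasiHopfAlgebra

namespace QuasitriangularQuasiHopfAlgebra

variable (H : QuasitriangularQuasiHopfAlgebra K A)

/-- `R' = ∑ t ⊗ s`, where `R = ∑ s ⊗ t`. -/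
def Rswap : (A ⊗[K] A)ˣ := Units.map (swap K A : A ⊗[K] A →* A ⊗[K] A) H.R

/-- `x ⊗ y ⊗ z ↦ ∑ S(y β S(z)) S(t) α s x`, where `R = ∑ s ⊗ t`. -/
def drinfeldMap : A ⊗[K] (A ⊗[K] A) →ₗ[K] A :=
  LinearMap.mul' K A ∘ₗ
    TensorProduct.map (H.S.toLinearMap ∘ₗ coevMap H.S H.β)
      (LinearMap.mulLeft K (evMap H.S H.α (swap K A (H.R : A ⊗[K] A)))) ∘ₗ
    (TensorProduct.comm K A (A ⊗[K] A)).toLinearMap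

/-- The Drinfel'd element `∑ S(Y' β S(Z')) S(t) α s X'`, where `R = ∑ s ⊗ t` and
`Φ⁻¹ = ∑ X' ⊗ Y' ⊗ Z'`. -/
def drinfeldElement : A := H.drinfeldMap H.Φinv

theorem drinfeldMap_tmul (x y z : A) : H.drinfeldMap (x ⊗ₜ (y ⊗ₜ z)) =
    H.S (y * H.β * H.S z) * evMap H.S H.α (swap K A (H.R : A ⊗[K] A)) * x :=
  (mul_assoc _ _ _).symm

end QuasitriangularQuasiHopfAlgebra

end QuasiHopf

end

/-! The proof rests on the uniqueness of antipodes up to a unit. For an algebra homomorphism `f : A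
→ B`, call `(S, α, β)` with values in `B` antipode data over `f` if it satisfies the antipode axioms
read through `f`. Two such data over the same `f` are related by an invertible `v` with `S₂(x) v = v
S₁(x)` and `v α₁ = α₂` (`AntipodeData.S_mul_compare`, `compare_mul_α`, `compare_mul_compare`), and
an intertwiner `v` is determined by `v α₁` (`eq_of_mul_α_eq`).

Both elements of the proposition are such comparisons. Over `Δ` there are the data `((S ⊗ S)Δᵒᵖ, γ,
δ)` and the image under `Δ` of `(S, α, β)`; the comparison is `F`. Over the identity of the
coopposite quasi-bialgebra there are `(S, ∑ S(t) α s, ∑ t̄ β S(s̄))`, where `R = ∑ s ⊗ t` and `R⁻¹ =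
∑ s̄ ⊗ t̄`, and `(S⁻¹, S⁻¹(α), S⁻¹(β))`; the comparison is `u`. This gives invertibility. The
intertwining relation `S(x) u = u S⁻¹(x)` is the formula for `S²`, and the counit of `u S⁻¹(α) = ∑
S(t) α s` gives `ε(u) = 1`.

For `Δ(u)`, both sides of the formula intertwine the images under `Δ` of the last two data, so they
need only agree after right multiplication by `Δ(S⁻¹(α))`. This amounts to `F Δ(∑ S(t) α s) R'R = (S
⊗ S)(γ') (u ⊗ u)` (`twist_mul_Δ_braidα`), which is a braid computation (`eval_braid`).

To avoid indices, tensors are evaluated on legs: homomorphisms `A → L` with commuting images,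
playing the role of objects. The convolution `conv` is their tensor product, `unitHom` the unit
object, `phi` the associator and `braid` the braiding. Duality enters through a linear map `E` on
`L` that cannot tell a convolution of two dual legs from the unit (`LeftEq` for evaluations,
`RightEq` for coevaluations). Under `E`, a coherence factor at the relevant end of a word becomes
trivial as soon as one of its legs is such a pair. -/

noncomputable section

namespace QuasiHopf

universe u v w w'

/-! ### Calculus of commuting legs; the associator, its pentagon and its units. -/

section

variable {K : Type u} {A : Type v} [Field K] [Ring A] [Algebra K A]
variable {L : Type w} [Ring L] [Algebra K L]

/-- Two algebra homomorphisms whose images commute. -/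
class CommHom (f g : A →ₐ[K] L) : Prop where
  comm : ∀ a b, Commute (f a) (g b)

theorem CommHom.symm {f g : A →ₐ[K] L} [h : CommHom f g] : CommHom g f :=
  ⟨fun a b => (h.comm b a).symm⟩

attribute [instance low] CommHom.symm

/-- `x ⊗ y ↦ f x * g y`. -/
def pair (f g : A →ₐ[K] L) [CommHom f g] : A ⊗[K] A →ₐ[K] L :=
  Algebra.TensorProduct.lift f g CommHom.comm

@[simp]
theorem pair_tmul (f g : A →ₐ[K] L) [CommHom f g] (x y : A) :
    pair f g (x ⊗ₜ y) = f x * g y := by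
  simp [pair]

theorem commute_pair {f g : A →ₐ[K] L} [CommHom f g] {c : L} (hf : ∀ a, Commute c (f a))
    (hg : ∀ a, Commute c (g a)) (D : A ⊗[K] A) : Commute c (pair f g D) := by
  induction D with
  | zero => simp
  | tmul x y => simpa using (hf x).mul_right (hg y)
  | add x y hx hy => simpa using hx.add_right hy

/-- `x ⊗ y ⊗ z ↦ f x * (g y * h z)`. -/
def triple (f g h : A →ₐ[K] L) [CommHom f g] [CommHom f h] [CommHom g h] :
    A ⊗[K] (A ⊗[K] A) →ₐ[K] L :=
  Algebra.TensorProduct.lift f (pair g h)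
    fun a D => commute_pair (CommHom.comm a) (CommHom.comm a) D

@[simp]
theorem triple_tmul (f g h : A →ₐ[K] L) [CommHom f g] [CommHom f h] [CommHom g h] (x y z : A) :
    triple f g h (x ⊗ₜ (y ⊗ₜ z)) = f x * (g y * h z) := by
  simp [triple]

theorem commute_triple {f g h : A →ₐ[K] L} [CommHom f g] [CommHom f h] [CommHom g h] {c : L}
    (hf : ∀ a, Commute c (f a)) (hg : ∀ a, Commute c (g a)) (hh : ∀ a, Commute c (h a))
    (P : A ⊗[K] (A ⊗[K] A)) : Commute c (triple f g h P) := by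
  induction P with
  | zero => simp
  | tmul x D =>
    simpa [triple] using (hf x).mul_right (commute_pair hg hh D)
  | add x y hx hy => simpa using hx.add_right hy

/-- Induction for the third tensor power. -/
theorem induction₃ {p : A ⊗[K] (A ⊗[K] A) → Prop} (zero : p 0)
    (tmul : ∀ x y z, p (x ⊗ₜ (y ⊗ₜ z))) (add : ∀ s t, p s → p t → p (s + t))
    (P : A ⊗[K] (A ⊗[K] A)) : p P := by
  induction P with
  | zero => exact zero
  | tmul x D =>
    induction D with
    | zero => simpa using zero
    | tmul y z => exact tmul x y z
    | add s t hs ht => simpa [TensorProduct.tmul_add] using add _ _ hs ht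
  | add s t hs ht => exact add s t hs ht

/-- Induction for the fourth tensor power. -/
theorem induction₄ {p : (A ⊗[K] A) ⊗[K] (A ⊗[K] A) → Prop} (zero : p 0)
    (tmul : ∀ x y z w, p ((x ⊗ₜ y) ⊗ₜ (z ⊗ₜ w))) (add : ∀ s t, p s → p t → p (s + t))
    (P : (A ⊗[K] A) ⊗[K] (A ⊗[K] A)) : p P := by
  induction P with
  | zero => exact zero
  | tmul C D =>
    induction C with
    | zero => simpa using zero
    | tmul x y =>
      induction D with
      | zero => simpa using zero
      | tmul z w => exact tmul x y z w
      | add s t hs ht => simpa [TensorProduct.tmul_add] using add _ _ hs ht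
    | add s t hs ht => simpa [TensorProduct.add_tmul] using add _ _ hs ht
  | add s t hs ht => exact add s t hs ht

/-- `f x * g y * h z * k w`. -/
def quadruple (f g h k : A →ₐ[K] L) [CommHom f g] [CommHom f h] [CommHom f k] [CommHom g h]
    [CommHom g k] [CommHom h k] : (A ⊗[K] A) ⊗[K] (A ⊗[K] A) →ₐ[K] L :=
  Algebra.TensorProduct.lift (pair f g) (pair h k) fun C D => by
    refine commute_pair (fun a => ?_) (fun a => ?_) D
    · exact (commute_pair (CommHom.comm a) (CommHom.comm a) C).symm
    · exact (commute_pair (CommHom.comm a) (CommHom.comm a) C).symm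

@[simp]
theorem quadruple_tmul (f g h k : A →ₐ[K] L) [CommHom f g] [CommHom f h] [CommHom f k]
    [CommHom g h] [CommHom g k] [CommHom h k] (C D : A ⊗[K] A) :
    quadruple f g h k (C ⊗ₜ D) = pair f g C * pair h k D := by
  simp [quadruple]

theorem commute_swap_left {f g : A →ₐ[K] L} [CommHom f g] (a b : A) (c : L) :
    f a * (g b * c) = g b * (f a * c) := by
  rw [← mul_assoc, (CommHom.comm a b : Commute (f a) (g b)).eq, mul_assoc]

section Conv

variable (Δ : A →ₐ[K] A ⊗[K] A)

/-- The homomorphism `a ↦ f a₁ * g a₂`. -/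
def conv (f g : A →ₐ[K] L) [CommHom f g] : A →ₐ[K] L := (pair f g).comp Δ

theorem conv_apply (f g : A →ₐ[K] L) [CommHom f g] (a : A) :
    conv Δ f g a = pair f g (Δ a) := rfl

instance commHom_conv (f g h : A →ₐ[K] L) [CommHom f g] [CommHom f h] [CommHom g h] :
    CommHom (conv Δ f g) h :=
  ⟨fun a b => (commute_pair (fun x => (CommHom.comm x b).symm)
    (fun x => (CommHom.comm x b).symm) (Δ a)).symm⟩

section

variable (f g h k : A →ₐ[K] L) [CommHom f g] [CommHom f h] [CommHom g h]

theorem pair_conv_right (D : A ⊗[K] A) :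
    pair f (conv Δ g h) D = triple f g h (idDelta Δ D) := by
  induction D with
  | zero => simp
  | tmul x y => simp [idDelta_tmul, triple, conv_apply]
  | add x y hx hy => simp only [map_add, hx, hy]

theorem triple_assoc_tmul (C : A ⊗[K] A) (y : A) :
    triple f g h (assoc K A (C ⊗ₜ y)) = pair f g C * h y := by
  induction C with
  | zero => simp
  | tmul u v => simp [assoc_tmul, mul_assoc]
  | add s t hs ht => rw [TensorProduct.add_tmul]; simp only [map_add, add_mul, hs, ht]

theorem pair_conv_left (D : A ⊗[K] A) :
    pair (conv Δ f g) h D = triple f g h (deltaId Δ D) := by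
  induction D with
  | zero => simp
  | tmul x y => rw [deltaId_tmul, triple_assoc_tmul, pair_tmul, conv_apply]
  | add x y hx hy => simp only [map_add, hx, hy]

variable [CommHom f k] [CommHom g k] [CommHom h k]

theorem quadruple_idIdDelta (P : A ⊗[K] (A ⊗[K] A)) :
    quadruple f g h k (idIdDelta Δ P) = triple f g (conv Δ h k) P := by
  induction P using induction₃ with
  | zero => simp
  | tmul x y z => simp [idIdDelta_tmul, conv_apply, mul_assoc]
  | add s t hs ht => simp only [map_add, hs, ht]

theorem quadruple_deltaIdId (P : A ⊗[K] (A ⊗[K] A)) :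
    quadruple f g h k (deltaIdId Δ P) = triple (conv Δ f g) h k P := by
  induction P using induction₃ with
  | zero => simp
  | tmul x y z => simp [deltaIdId_tmul, conv_apply]
  | add s t hs ht => simp only [map_add, hs, ht]

theorem quadruple_leg234 (P : A ⊗[K] (A ⊗[K] A)) :
    quadruple f g h k (leg234 K A P) = triple g h k P := by
  induction P using induction₃ with
  | zero => simp
  | tmul x y z => simp [leg234_tmul]
  | add s t hs ht => simp only [map_add, hs, ht]

theorem quadruple_leg123 (P : A ⊗[K] (A ⊗[K] A)) :
    quadruple f g h k (leg123 K A P) = triple f g h P := by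
  induction P using induction₃ with
  | zero => simp
  | tmul x y z => simp [leg123_tmul, mul_assoc]
  | add s t hs ht => simp only [map_add, hs, ht]

theorem quadruple_moveSecond (x z : A) (D : A ⊗[K] A) :
    quadruple f g h k (moveSecond K A ((x ⊗ₜ z) ⊗ₜ D)) = f x * (pair g h D * k z) := by
  induction D with
  | zero => simp
  | tmul u v => simp [moveSecond_tmul, mul_assoc]
  | add s t hs ht => rw [TensorProduct.tmul_add]; simp only [map_add, mul_add, add_mul, hs, ht]

theorem quadruple_idDeltaId (P : A ⊗[K] (A ⊗[K] A)) :
    quadruple f g h k (idDeltaId Δ P) = triple f (conv Δ g h) k P := by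
  induction P using induction₃ with
  | zero => simp
  | tmul x y z => rw [idDeltaId_tmul, quadruple_moveSecond, triple_tmul, conv_apply]
  | add s t hs ht => simp only [map_add, hs, ht]

end

end Conv

namespace QuasiBialgebra

variable (Q : QuasiBialgebra K A)

variable (L) in
/-- The homomorphism `a ↦ ε a`. -/
def unitHom : A →ₐ[K] L := (Algebra.ofId K L).comp Q.ε

theorem unitHom_apply (a : A) : Q.unitHom L a = algebraMap K L (Q.ε a) := rfl

instance commHom_unitHom (f : A →ₐ[K] L) : CommHom (Q.unitHom L) f :=
  ⟨fun a _ => Algebra.commutes (Q.ε a) _⟩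

@[simp]
theorem conv_unitHom_left (f : A →ₐ[K] L) : conv Q.Δ (Q.unitHom L) f = f := by
  have key : pair (Q.unitHom L) f = f.comp (epsId Q.ε) := by
    apply Algebra.TensorProduct.ext'
    intro x y
    simp [epsId_tmul, unitHom_apply, Algebra.smul_def]
  ext a
  rw [conv_apply, key, AlgHom.comp_apply, Q.counit_left]

@[simp]
theorem conv_unitHom_right (f : A →ₐ[K] L) : conv Q.Δ f (Q.unitHom L) = f := by
  have key : pair f (Q.unitHom L) = f.comp (idEps Q.ε) := by
    apply Algebra.TensorProduct.ext'
    intro x y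
    simp [idEps_tmul, unitHom_apply, Algebra.smul_def, Algebra.commutes]
  ext a
  rw [conv_apply, key, AlgHom.comp_apply, Q.counit_right]

/-- The image of the associator under `x ⊗ y ⊗ z ↦ f x * g y * h z`. -/
def phi (f g h : A →ₐ[K] L) [CommHom f g] [CommHom f h] [CommHom g h] : Lˣ :=
  Units.map (triple f g h : A ⊗[K] (A ⊗[K] A) →* L) Q.Φ

section

variable (f g h k : A →ₐ[K] L) [CommHom f g] [CommHom f h] [CommHom g h]

theorem val_phi : (Q.phi f g h : L) = triple f g h (Q.Φ : A ⊗[K] (A ⊗[K] A)) := rfl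

theorem val_phi_inv : ((Q.phi f g h)⁻¹ : Lˣ) =
    triple f g h ((Q.Φ⁻¹ : (A ⊗[K] (A ⊗[K] A))ˣ) : A ⊗[K] (A ⊗[K] A)) := rfl

theorem conv_assoc (a : A) :
    conv Q.Δ f (conv Q.Δ g h) a * Q.phi f g h = Q.phi f g h * conv Q.Δ (conv Q.Δ f g) h a := by
  rw [conv_apply, conv_apply, pair_conv_right, pair_conv_left, val_phi, ← map_mul, ← map_mul,
    Q.quasi_coassoc]

theorem phi_unitHom_mid : Q.phi f (Q.unitHom L) h = 1 := by
  have key : triple f (Q.unitHom L) h = (pair f h).comp (idEpsId Q.ε) := by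
    apply AlgHom.toLinearMap_injective
    ext x y z
    simp [idEpsId_tmul, unitHom_apply, Algebra.smul_def]
  ext
  rw [val_phi, key, AlgHom.comp_apply, Q.counit_associator, map_one, Units.val_one]

variable [CommHom f k] [CommHom g k] [CommHom h k]

theorem phi_pentagon : Q.phi f g (conv Q.Δ h k) * Q.phi (conv Q.Δ f g) h k =
    Q.phi g h k * Q.phi f (conv Q.Δ g h) k * Q.phi f g h := by
  ext
  simpa only [Units.val_mul, val_phi, map_mul, quadruple_idIdDelta, quadruple_deltaIdId,
    quadruple_leg234, quadruple_leg123, quadruple_idDeltaId] using congrArg (quadruple f g h k) Q.pentagon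

end

section

variable (f g h : A →ₐ[K] L) [CommHom f g]

theorem phi_unitHom_left : Q.phi (Q.unitHom L) f g = 1 := by
  have h := Q.phi_pentagon (Q.unitHom L) (Q.unitHom L) f g
  simp only [phi_unitHom_mid, conv_unitHom_left, one_mul, mul_one] at h
  exact mul_eq_left.mp h.symm

theorem phi_unitHom_right : Q.phi f g (Q.unitHom L) = 1 := by
  have h := Q.phi_pentagon f g (Q.unitHom L) (Q.unitHom L)
  simp only [phi_unitHom_mid, conv_unitHom_right, one_mul, mul_one] at h
  exact mul_eq_left.mp h.symm

end

end QuasiBialgebra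

end

/-! ### Naturality of the associator, and linear maps that cannot distinguish two legs. -/

section

variable {K : Type u} {A : Type v} [Field K] [Ring A] [Algebra K A]
variable {L : Type w} [Ring L] [Algebra K L]

section Intertwine

variable {X : L} {m m' : A →ₐ[K] L}

/-- Naturality: `X` acts as a morphism from `m` to `m'` and passes through the untouched legs. -/
theorem mul_triple₁ {f g : A →ₐ[K] L} [CommHom m f] [CommHom m g] [CommHom m' f] [CommHom m' g]
    [CommHom f g] (hm : ∀ a, X * m a = m' a * X) (hf : ∀ a, Commute X (f a))
    (hg : ∀ a, Commute X (g a)) (P : A ⊗[K] (A ⊗[K] A)) :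
    X * triple m f g P = triple m' f g P * X := by
  induction P using induction₃ with
  | zero => simp
  | tmul x y z =>
    simp only [triple_tmul]
    rw [← mul_assoc, hm, mul_assoc, ← mul_assoc X, (hf y).eq, mul_assoc, (hg z).eq]
    simp only [mul_assoc]
  | add s t hs ht => simp only [map_add, mul_add, add_mul, hs, ht]

theorem mul_triple₂ {f g : A →ₐ[K] L} [CommHom f m] [CommHom m g] [CommHom f m'] [CommHom m' g]
    [CommHom f g] (hm : ∀ a, X * m a = m' a * X) (hf : ∀ a, Commute X (f a))
    (hg : ∀ a, Commute X (g a)) (P : A ⊗[K] (A ⊗[K] A)) :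
    X * triple f m g P = triple f m' g P * X := by
  induction P using induction₃ with
  | zero => simp
  | tmul x y z =>
    simp only [triple_tmul]
    rw [← mul_assoc, (hf x).eq, mul_assoc, ← mul_assoc X, hm, mul_assoc, (hg z).eq]
    simp only [mul_assoc]
  | add s t hs ht => simp only [map_add, mul_add, add_mul, hs, ht]

theorem mul_pair₁ {f : A →ₐ[K] L} [CommHom m f] [CommHom m' f]
    (hm : ∀ a, X * m a = m' a * X) (hf : ∀ a, Commute X (f a)) (D : A ⊗[K] A) :
    X * pair m f D = pair m' f D * X := by
  induction D with
  | zero => simp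
  | tmul x y =>
    simp only [pair_tmul]
    rw [← mul_assoc, hm, mul_assoc, (hf y).eq, mul_assoc]
  | add s t hs ht => simp only [map_add, mul_add, add_mul, hs, ht]

theorem mul_pair₂ {f : A →ₐ[K] L} [CommHom f m] [CommHom f m']
    (hm : ∀ a, X * m a = m' a * X) (hf : ∀ a, Commute X (f a)) (D : A ⊗[K] A) :
    X * pair f m D = pair f m' D * X := by
  induction D with
  | zero => simp
  | tmul x y =>
    simp only [pair_tmul]
    rw [← mul_assoc, (hf x).eq, mul_assoc, hm, mul_assoc]
  | add s t hs ht => simp only [map_add, mul_add, add_mul, hs, ht]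

theorem mul_conv₁ (Δ : A →ₐ[K] A ⊗[K] A) {f : A →ₐ[K] L} [CommHom m f] [CommHom m' f]
    (hm : ∀ a, X * m a = m' a * X) (hf : ∀ a, Commute X (f a)) (a : A) :
    X * conv Δ m f a = conv Δ m' f a * X :=
  mul_pair₁ hm hf (Δ a)

theorem mul_conv₂ (Δ : A →ₐ[K] A ⊗[K] A) {f : A →ₐ[K] L} [CommHom f m] [CommHom f m']
    (hm : ∀ a, X * m a = m' a * X) (hf : ∀ a, Commute X (f a)) (a : A) :
    X * conv Δ f m a = conv Δ f m' a * X :=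
  mul_pair₂ hm hf (Δ a)

end Intertwine

section Kill

variable {M : Type w'} [AddCommGroup M] [Module K M]

/-- `E` does not distinguish left multiplication by `m a` and by `m' a`. -/
def LeftEq (E : L →ₗ[K] M) (m m' : A →ₐ[K] L) : Prop := ∀ a T, E (m a * T) = E (m' a * T)

/-- `E` does not distinguish right multiplication by `m a` and by `m' a`. -/
def RightEq (E : L →ₗ[K] M) (m m' : A →ₐ[K] L) : Prop := ∀ a T, E (T * m a) = E (T * m' a)

variable {E : L →ₗ[K] M} {m m' m'' : A →ₐ[K] L}

namespace LeftEq

theorem trans (h : LeftEq E m m') (h' : LeftEq E m' m'') : LeftEq E m m'' :=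
  fun a T => (h a T).trans (h' a T)

/-- Carries a collapse past a fixed leading factor `X`, at the cost of conjugating the legs by `X`.
-/
theorem intertwine (h : LeftEq E m m') {n n' : A →ₐ[K] L} {X : L}
    (hX : ∀ a, X * n a = m a * X) (hX' : ∀ a, X * n' a = m' a * X) :
    LeftEq (E ∘ₗ LinearMap.mulLeft K X) n n' := by
  intro a T
  simp only [LinearMap.comp_apply, LinearMap.mulLeft_apply]
  rw [← mul_assoc, hX, mul_assoc, h, ← mul_assoc, ← hX', mul_assoc]

theorem mulLeft (h : LeftEq E m m') {X : L} (hX : ∀ a, Commute X (m a))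
    (hX' : ∀ a, Commute X (m' a)) : LeftEq (E ∘ₗ LinearMap.mulLeft K X) m m' :=
  h.intertwine hX hX'

variable {f g : A →ₐ[K] L}

theorem pair₁ [CommHom m f] [CommHom m' f] (h : LeftEq E m m') (D : A ⊗[K] A) (T : L) :
    E (pair m f D * T) = E (pair m' f D * T) := by
  induction D with
  | zero => simp
  | tmul x y => simpa only [pair_tmul, mul_assoc] using h x _
  | add s t hs ht => simp only [map_add, add_mul, hs, ht]

theorem pair₂ [CommHom f m] [CommHom f m'] (h : LeftEq E m m') (D : A ⊗[K] A) (T : L) :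
    E (pair f m D * T) = E (pair f m' D * T) := by
  induction D with
  | zero => simp
  | tmul x y =>
    simpa only [pair_tmul, mul_assoc, commute_swap_left (f := f) (g := m),
      commute_swap_left (f := f) (g := m')] using h y (f x * T)
  | add s t hs ht => simp only [map_add, add_mul, hs, ht]

theorem triple₁ [CommHom m f] [CommHom m g] [CommHom m' f] [CommHom m' g] [CommHom f g]
    (h : LeftEq E m m') (P : A ⊗[K] (A ⊗[K] A)) (T : L) :
    E (triple m f g P * T) = E (triple m' f g P * T) := by
  induction P using induction₃ with
  | zero => simp
  | tmul x y z => simpa only [triple_tmul, mul_assoc] using h x _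
  | add s t hs ht => simp only [map_add, add_mul, hs, ht]

theorem triple₂ [CommHom f m] [CommHom m g] [CommHom f m'] [CommHom m' g] [CommHom f g]
    (h : LeftEq E m m') (P : A ⊗[K] (A ⊗[K] A)) (T : L) :
    E (triple f m g P * T) = E (triple f m' g P * T) := by
  induction P using induction₃ with
  | zero => simp
  | tmul x y z =>
    simpa only [triple_tmul, mul_assoc, commute_swap_left (f := f) (g := m),
      commute_swap_left (f := f) (g := m')] using h y (f x * (g z * T))
  | add s t hs ht => simp only [map_add, add_mul, hs, ht]

theorem triple₃ [CommHom f m] [CommHom g m] [CommHom f m'] [CommHom g m'] [CommHom f g]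
    (h : LeftEq E m m') (P : A ⊗[K] (A ⊗[K] A)) (T : L) :
    E (triple f g m P * T) = E (triple f g m' P * T) := by
  induction P using induction₃ with
  | zero => simp
  | tmul x y z =>
    simpa only [triple_tmul, mul_assoc, commute_swap_left (f := f) (g := m),
      commute_swap_left (f := f) (g := m'), commute_swap_left (f := g) (g := m),
      commute_swap_left (f := g) (g := m')] using h z (f x * (g y * T))
  | add s t hs ht => simp only [map_add, add_mul, hs, ht]

theorem conv₁ (Δ : A →ₐ[K] A ⊗[K] A) [CommHom m f] [CommHom m' f] (h : LeftEq E m m') :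
    LeftEq E (conv Δ m f) (conv Δ m' f) :=
  fun a T => h.pair₁ (Δ a) T

theorem conv₂ (Δ : A →ₐ[K] A ⊗[K] A) [CommHom f m] [CommHom f m'] (h : LeftEq E m m') :
    LeftEq E (conv Δ f m) (conv Δ f m') :=
  fun a T => h.pair₂ (Δ a) T

end LeftEq

namespace RightEq

theorem trans (h : RightEq E m m') (h' : RightEq E m' m'') : RightEq E m m'' :=
  fun a T => (h a T).trans (h' a T)

theorem intertwine (h : RightEq E m m') {n n' : A →ₐ[K] L} {X : L}
    (hX : ∀ a, X * m a = n a * X) (hX' : ∀ a, X * m' a = n' a * X) :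
    RightEq (E ∘ₗ LinearMap.mulRight K X) n n' := by
  intro a T
  simp only [LinearMap.comp_apply, LinearMap.mulRight_apply]
  rw [mul_assoc, ← hX, ← mul_assoc, h, mul_assoc, hX', ← mul_assoc]

theorem mulRight (h : RightEq E m m') {X : L} (hX : ∀ a, Commute X (m a))
    (hX' : ∀ a, Commute X (m' a)) : RightEq (E ∘ₗ LinearMap.mulRight K X) m m' :=
  h.intertwine hX hX'

variable {f g : A →ₐ[K] L}

theorem pair₁ [CommHom m f] [CommHom m' f] (h : RightEq E m m') (D : A ⊗[K] A) (T : L) :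
    E (T * pair m f D) = E (T * pair m' f D) := by
  induction D with
  | zero => simp
  | tmul x y =>
    have := h x (T * f y)
    rwa [mul_assoc, mul_assoc, ← (CommHom.comm x y : Commute (m x) (f y)).eq,
      ← (CommHom.comm x y : Commute (m' x) (f y)).eq, ← pair_tmul, ← pair_tmul] at this
  | add s t hs ht => simp only [map_add, mul_add, hs, ht]

theorem pair₂ [CommHom f m] [CommHom f m'] (h : RightEq E m m') (D : A ⊗[K] A) (T : L) :
    E (T * pair f m D) = E (T * pair f m' D) := by
  induction D with
  | zero => simp
  | tmul x y => simpa only [pair_tmul, mul_assoc] using h y (T * f x)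
  | add s t hs ht => simp only [map_add, mul_add, hs, ht]

theorem triple₁ [CommHom m f] [CommHom m g] [CommHom m' f] [CommHom m' g] [CommHom f g]
    (h : RightEq E m m') (P : A ⊗[K] (A ⊗[K] A)) (T : L) :
    E (T * triple m f g P) = E (T * triple m' f g P) := by
  induction P using induction₃ with
  | zero => simp
  | tmul x y z =>
    have := h x (T * (f y * g z))
    rwa [mul_assoc T, mul_assoc T,
      ← ((CommHom.comm x y : Commute (m x) (f y)).mul_right (CommHom.comm x z)).eq,
      ← ((CommHom.comm x y : Commute (m' x) (f y)).mul_right (CommHom.comm x z)).eq,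
      ← triple_tmul, ← triple_tmul] at this
  | add s t hs ht => simp only [map_add, mul_add, hs, ht]

theorem triple₂ [CommHom f m] [CommHom m g] [CommHom f m'] [CommHom m' g] [CommHom f g]
    (h : RightEq E m m') (P : A ⊗[K] (A ⊗[K] A)) (T : L) :
    E (T * triple f m g P) = E (T * triple f m' g P) := by
  induction P using induction₃ with
  | zero => simp
  | tmul x y z =>
    have := h y (T * (f x * g z))
    rwa [mul_assoc, mul_assoc, mul_assoc, mul_assoc,
      ← (CommHom.comm y z : Commute (m y) (g z)).eq,
      ← (CommHom.comm y z : Commute (m' y) (g z)).eq,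
      ← triple_tmul, ← triple_tmul] at this
  | add s t hs ht => simp only [map_add, mul_add, hs, ht]

theorem conv₁ (Δ : A →ₐ[K] A ⊗[K] A) [CommHom m f] [CommHom m' f] (h : RightEq E m m') :
    RightEq E (conv Δ m f) (conv Δ m' f) :=
  fun a T => h.pair₁ (Δ a) T

theorem conv₂ (Δ : A →ₐ[K] A ⊗[K] A) [CommHom f m] [CommHom f m'] (h : RightEq E m m') :
    RightEq E (conv Δ f m) (conv Δ f m') :=
  fun a T => h.pair₂ (Δ a) T

end RightEq

namespace QuasiBialgebra

variable (Q : QuasiBialgebra K A) {f g h k : A →ₐ[K] L}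

theorem mul_phi₁ [CommHom m f] [CommHom m g] [CommHom m' f] [CommHom m' g] [CommHom f g] {X : Lˣ}
    (hm : ∀ a, X * m a = m' a * X) (hf : ∀ a, Commute (X : L) (f a))
    (hg : ∀ a, Commute (X : L) (g a)) : X * Q.phi m f g = Q.phi m' f g * X :=
  Units.ext (mul_triple₁ hm hf hg _)

theorem mul_phi₂ [CommHom f m] [CommHom m g] [CommHom f m'] [CommHom m' g] [CommHom f g] {X : Lˣ}
    (hm : ∀ a, X * m a = m' a * X) (hf : ∀ a, Commute (X : L) (f a))
    (hg : ∀ a, Commute (X : L) (g a)) : X * Q.phi f m g = Q.phi f m' g * X :=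
  Units.ext (mul_triple₂ hm hf hg _)

theorem commute_phi [CommHom f g] [CommHom f h] [CommHom g h] [CommHom k f] [CommHom k g]
    [CommHom k h] (a : A) : Commute (Q.phi f g h : L) (k a) :=
  (commute_triple (CommHom.comm a) (CommHom.comm a) (CommHom.comm a) _).symm

theorem commute_phi_inv [CommHom f g] [CommHom f h] [CommHom g h] [CommHom k f] [CommHom k g]
    [CommHom k h] (a : A) : Commute (((Q.phi f g h)⁻¹ : Lˣ) : L) (k a) :=
  (commute_triple (CommHom.comm a) (CommHom.comm a) (CommHom.comm a) _).symm

theorem conv_assoc_symm [CommHom f g] [CommHom f h] [CommHom g h] (a : A) :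
    ((Q.phi f g h)⁻¹ : Lˣ) * conv Q.Δ f (conv Q.Δ g h) a =
      conv Q.Δ (conv Q.Δ f g) h a * ((Q.phi f g h)⁻¹ : Lˣ) := by
  rw [Units.inv_mul_eq_iff_eq_mul, ← mul_assoc, ← Q.conv_assoc, Units.mul_inv_cancel_right]

theorem leftEq_phi₁ [CommHom m f] [CommHom m g] [CommHom m' f] [CommHom m' g] [CommHom f g]
    (h : LeftEq E m m') (T : Lˣ) : E ↑(Q.phi m f g * T) = E ↑(Q.phi m' f g * T) :=
  h.triple₁ _ _

theorem leftEq_phi_inv₁ [CommHom m f] [CommHom m g] [CommHom m' f] [CommHom m' g] [CommHom f g]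
    (h : LeftEq E m m') (T : Lˣ) : E ↑((Q.phi m f g)⁻¹ * T) = E ↑((Q.phi m' f g)⁻¹ * T) :=
  h.triple₁ _ _

theorem leftEq_phi₂ [CommHom f m] [CommHom m g] [CommHom f m'] [CommHom m' g] [CommHom f g]
    (h : LeftEq E m m') (T : Lˣ) : E ↑(Q.phi f m g * T) = E ↑(Q.phi f m' g * T) :=
  h.triple₂ _ _

theorem leftEq_phi₃ [CommHom f m] [CommHom g m] [CommHom f m'] [CommHom g m'] [CommHom f g]
    (h : LeftEq E m m') (T : Lˣ) : E ↑(Q.phi f g m * T) = E ↑(Q.phi f g m' * T) :=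
  h.triple₃ _ _

theorem leftEq_phi_inv₃ [CommHom f m] [CommHom g m] [CommHom f m'] [CommHom g m'] [CommHom f g]
    (h : LeftEq E m m') (T : Lˣ) : E ↑((Q.phi f g m)⁻¹ * T) = E ↑((Q.phi f g m')⁻¹ * T) :=
  h.triple₃ _ _

theorem rightEq_phi₁ [CommHom m f] [CommHom m g] [CommHom m' f] [CommHom m' g] [CommHom f g]
    (h : RightEq E m m') (T : Lˣ) : E ↑(T * Q.phi m f g) = E ↑(T * Q.phi m' f g) :=
  h.triple₁ _ _

theorem rightEq_phi_inv₁ [CommHom m f] [CommHom m g] [CommHom m' f] [CommHom m' g] [CommHom f g]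
    (h : RightEq E m m') (T : Lˣ) : E ↑(T * (Q.phi m f g)⁻¹) = E ↑(T * (Q.phi m' f g)⁻¹) :=
  h.triple₁ _ _

theorem rightEq_phi₂ [CommHom f m] [CommHom m g] [CommHom f m'] [CommHom m' g] [CommHom f g]
    (h : RightEq E m m') (T : Lˣ) : E ↑(T * Q.phi f m g) = E ↑(T * Q.phi f m' g) :=
  h.triple₂ _ _

end QuasiBialgebra

end Kill

end

/-! ### Consequences of the pentagon for dual legs. -/

section

variable {K : Type u} {A : Type v} [Field K] [Ring A] [Algebra K A]
variable {L : Type w} [Ring L] [Algebra K L]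
variable {M : Type w'} [AddCommGroup M] [Module K M]

namespace QuasiBialgebra

variable (Q : QuasiBialgebra K A)

section Four

variable {a b c d : A →ₐ[K] L} [CommHom a b] [CommHom a c] [CommHom a d] [CommHom b c]
  [CommHom b d] [CommHom c d]

/-- The left side is the word defining `γ`. In the other form its leading associator contains the
inner pair `bc` as one leg, so it vanishes when that pair is evaluated. -/
theorem phi_inv_mul_phi : (Q.phi b c d)⁻¹ * Q.phi a b (conv Q.Δ c d) =
    Q.phi a (conv Q.Δ b c) d * (Q.phi a b c * (Q.phi (conv Q.Δ a b) c d)⁻¹) := by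
  rw [inv_mul_eq_iff_eq_mul, ← mul_assoc, ← mul_assoc, eq_mul_inv_iff_mul_eq, Q.phi_pentagon]

/-- In the pentagon for `a, b, c, d`, three of the five associators have one of `ab`, `bc`, `cd` as
a leg, hence a unit leg under `E`; the other two are the sides of this equation. -/
theorem eval_phi_inv {E : L →ₗ[K] M} (hab : LeftEq E (conv Q.Δ a b) (Q.unitHom L))
    (hcd : LeftEq E (conv Q.Δ c d) (Q.unitHom L)) (hbc : RightEq E (conv Q.Δ b c) (Q.unitHom L)) :
    E ↑(Q.phi a b c)⁻¹ = E ↑(Q.phi b c d) := by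
  have h : (Q.phi a b c)⁻¹ * (Q.phi a (conv Q.Δ b c) d)⁻¹ = (Q.phi (conv Q.Δ a b) c d)⁻¹ *
      ((Q.phi a b (conv Q.Δ c d))⁻¹ * Q.phi b c d) := by
    rw [eq_inv_mul_iff_mul_eq, eq_inv_mul_iff_mul_eq, ← mul_assoc, Q.phi_pentagon]
    group
  -- The associator with leg `bc` is appended on the right: it cancels its inverse on one side, and
  -- its middle leg is replaced by the unit on the other.
  have h2 := Q.rightEq_phi₂ (f := a) (g := d) hbc
    ((Q.phi a b c)⁻¹ * (Q.phi a (conv Q.Δ b c) d)⁻¹)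
  rw [inv_mul_cancel_right, phi_unitHom_mid, mul_one, h, Q.leftEq_phi_inv₁ hab,
    phi_unitHom_left, inv_one, one_mul, Q.leftEq_phi_inv₃ hcd, phi_unitHom_right, inv_one,
    one_mul] at h2
  exact h2

end Four

section Six

variable (a b c d e f : A →ₐ[K] L) [CommHom a b] [CommHom a c] [CommHom a d] [CommHom a e]
  [CommHom a f] [CommHom b c] [CommHom b d] [CommHom b e] [CommHom b f] [CommHom c d] [CommHom c e]
  [CommHom c f] [CommHom d e] [CommHom d f] [CommHom e f]

/-- The two zigzag identities for nested dual pairs, with the pairs `(a, d)`, `(b, c)` created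
and the pairs `(d, e)`, `(c, f)` annihilated. -/
theorem eval_zigzag {E : L →ₗ[K] M} (hde : LeftEq E (conv Q.Δ d e) (Q.unitHom L))
    (hcf : LeftEq E (conv Q.Δ c f) (Q.unitHom L)) (hbc : RightEq E (conv Q.Δ b c) (Q.unitHom L))
    (had : RightEq E (conv Q.Δ a d) (Q.unitHom L)) :
    E ↑(Q.phi c d e * (Q.phi (conv Q.Δ c d) e f)⁻¹ *
      Q.phi (conv Q.Δ a b) (conv Q.Δ c d) (conv Q.Δ e f) *
      (Q.phi (conv Q.Δ a b) c d * (Q.phi a b c)⁻¹)) = E ↑(Q.phi b c f * Q.phi a d e) := by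
  set U := conv Q.Δ a b with hU
  -- the pentagon for `U, cd, e, f` and naturality
  have h1 : Q.phi c d e * (Q.phi (conv Q.Δ c d) e f)⁻¹ * Q.phi U (conv Q.Δ c d) (conv Q.Δ e f) *
      (Q.phi U c d * (Q.phi a b c)⁻¹) =
      Q.phi U (conv Q.Δ c (conv Q.Δ d e)) f * (Q.phi c d e * Q.phi U (conv Q.Δ c d) e *
        ((Q.phi (conv Q.Δ U (conv Q.Δ c d)) e f)⁻¹ * (Q.phi U c d * (Q.phi a b c)⁻¹))) := by
    have h := Q.mul_phi₂ (f := U) (g := f) (X := Q.phi c d e)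
      (fun x => (Q.conv_assoc c d e x).symm)
      (fun x => Q.commute_phi x) (fun x => Q.commute_phi x)
    rw [mul_assoc (Q.phi c d e), Q.phi_inv_mul_phi]
    simp only [← mul_assoc, h]
  -- The collapse of `de` passes through the convolution with `c`, where the counit axiom removes
  -- it.
  have k1 : LeftEq E (conv Q.Δ c (conv Q.Δ d e)) c := by
    simpa using hde.conv₂ Q.Δ (f := c)
  rw [h1, Q.leftEq_phi₂ k1]
  -- moving the next associator to the right
  have h2 : (Q.phi (conv Q.Δ U (conv Q.Δ c d)) e f)⁻¹ * (Q.phi U c d * (Q.phi a b c)⁻¹) =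
      Q.phi U c d * (Q.phi a b c)⁻¹ *
        (Q.phi (conv Q.Δ (conv Q.Δ a (conv Q.Δ b c)) d) e f)⁻¹ := by
    have h := Q.mul_phi₁ (f := e) (g := f) (X := (Q.phi U c d)⁻¹)
      (Q.conv_assoc_symm) (fun x => Q.commute_phi_inv x) (fun x => Q.commute_phi_inv x)
    have h' := Q.mul_phi₁ (f := e) (g := f) (X := Q.phi a b c)
      (mul_conv₁ Q.Δ (f := d) (fun x => (Q.conv_assoc a b c x).symm) (fun x => Q.commute_phi x))
      (fun x => Q.commute_phi x) (fun x => Q.commute_phi x)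
    have hV : Q.phi (conv Q.Δ U (conv Q.Δ c d)) e f = Q.phi U c d * ((Q.phi a b c)⁻¹ *
        Q.phi (conv Q.Δ (conv Q.Δ a (conv Q.Δ b c)) d) e f * Q.phi a b c) * (Q.phi U c d)⁻¹ := by
      rw [mul_assoc (Q.phi a b c)⁻¹, ← h', inv_mul_cancel_left, mul_assoc, ← h,
        mul_inv_cancel_left]
    rw [hV]
    group
  -- Nested pairs collapse from the inside: `bc` first, which leaves `ad`.
  have k2 : RightEq E (conv Q.Δ (conv Q.Δ a (conv Q.Δ b c)) d) (Q.unitHom L) := by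
    have h := hbc.conv₂ Q.Δ (f := a)
    rw [conv_unitHom_right] at h
    exact (h.conv₁ Q.Δ).trans had
  rw [h2, ← mul_assoc, ← mul_assoc, Q.rightEq_phi_inv₁ k2, phi_unitHom_left, inv_one, mul_one]
  -- the pentagon for `U, c, d, e`
  have h3 : Q.phi U c f * (Q.phi c d e * Q.phi U (conv Q.Δ c d) e) *
      (Q.phi U c d * (Q.phi a b c)⁻¹) = Q.phi U c f * (Q.phi U c (conv Q.Δ d e) *
        (Q.phi (conv Q.Δ U c) d e * (Q.phi a b c)⁻¹)) := by
    have h := Q.phi_pentagon U c d e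
    rw [← mul_assoc (Q.phi U c (conv Q.Δ d e)), h]
    group
  have k3 : LeftEq (E ∘ₗ LinearMap.mulLeft K (Q.phi U c f : L)) (conv Q.Δ d e) (Q.unitHom L) :=
    hde.mulLeft (fun x => Q.commute_phi x) (fun x => Q.commute_phi x)
  have h4 := Q.leftEq_phi₃ (f := U) (g := c) k3 (Q.phi (conv Q.Δ U c) d e * (Q.phi a b c)⁻¹)
  rw [phi_unitHom_right, one_mul] at h4
  simp only [LinearMap.comp_apply, LinearMap.mulLeft_apply, ← Units.val_mul] at h4
  rw [h3, h4]
  -- naturality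
  have h5 : Q.phi U c f * (Q.phi (conv Q.Δ U c) d e * (Q.phi a b c)⁻¹) =
      Q.phi U c f * (Q.phi a b c)⁻¹ * Q.phi (conv Q.Δ a (conv Q.Δ b c)) d e := by
    rw [mul_assoc, ← Q.mul_phi₁ (f := d) (g := e) (X := (Q.phi a b c)⁻¹)
      (Q.conv_assoc_symm) (fun x => Q.commute_phi_inv x) (fun x => Q.commute_phi_inv x)]
  have k5 : RightEq E (conv Q.Δ a (conv Q.Δ b c)) a := by
    simpa using hbc.conv₂ Q.Δ (f := a)
  rw [h5, Q.rightEq_phi₁ k5]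
  -- the pentagon for `a, b, c, f`
  have h6 : Q.phi U c f * (Q.phi a b c)⁻¹ * Q.phi a d e =
      (Q.phi a b (conv Q.Δ c f))⁻¹ * (Q.phi b c f * Q.phi a (conv Q.Δ b c) f * Q.phi a d e) := by
    have h := Q.phi_pentagon a b c f
    rw [eq_inv_mul_iff_mul_eq, ← mul_assoc, ← mul_assoc, h]
    group
  rw [h6, Q.leftEq_phi_inv₃ hcf, phi_unitHom_right, inv_one, one_mul]
  have k7 : RightEq (E ∘ₗ LinearMap.mulRight K (Q.phi a d e : L)) (conv Q.Δ b c) (Q.unitHom L) :=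
    hbc.mulRight (fun x => Q.commute_phi x) (fun x => Q.commute_phi x)
  have h7 := Q.rightEq_phi₂ (f := a) (g := f) k7 (Q.phi b c f)
  rw [phi_unitHom_mid, mul_one] at h7
  simpa only [LinearMap.comp_apply, LinearMap.mulRight_apply, ← Units.val_mul] using h7

end Six

end QuasiBialgebra

end

/-! ### The standard legs of tensor powers; the coopposite quasi-bialgebra. -/

section

variable {K : Type u} {A : Type v} [Field K] [Ring A] [Algebra K A]

section Legs

variable {B : Type w} {C : Type w'} [Ring B] [Algebra K B] [Ring C] [Algebra K C]

instance commHom_includeLeft_includeRight (f : A →ₐ[K] B) (g : A →ₐ[K] C) :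
    CommHom ((Algebra.TensorProduct.includeLeft : B →ₐ[K] B ⊗[K] C).comp f)
      ((Algebra.TensorProduct.includeRight : C →ₐ[K] B ⊗[K] C).comp g) :=
  ⟨fun a b => by simp [Commute, SemiconjBy]⟩

instance commHom_comp (j : B →ₐ[K] C) (f g : A →ₐ[K] B) [CommHom f g] :
    CommHom (j.comp f) (j.comp g) :=
  ⟨fun a b => (CommHom.comm a b : Commute (f a) (g b)).map j⟩

variable (K A)

/-- `a ↦ a ⊗ 1`. -/
def two₁ : A →ₐ[K] A ⊗[K] A := Algebra.TensorProduct.includeLeft.comp (AlgHom.id K A)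

/-- `a ↦ 1 ⊗ a`. -/
def two₂ : A →ₐ[K] A ⊗[K] A := Algebra.TensorProduct.includeRight.comp (AlgHom.id K A)

instance commHom_two₁₂ : CommHom (two₁ K A) (two₂ K A) :=
  commHom_includeLeft_includeRight _ _

/-- `a ↦ a ⊗ 1 ⊗ 1`. -/
def tri₁ : A →ₐ[K] A ⊗[K] (A ⊗[K] A) := Algebra.TensorProduct.includeLeft.comp (AlgHom.id K A)

/-- `a ↦ 1 ⊗ a ⊗ 1`. -/
def tri₂ : A →ₐ[K] A ⊗[K] (A ⊗[K] A) := Algebra.TensorProduct.includeRight.comp (two₁ K A)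

/-- `a ↦ 1 ⊗ 1 ⊗ a`. -/
def tri₃ : A →ₐ[K] A ⊗[K] (A ⊗[K] A) := Algebra.TensorProduct.includeRight.comp (two₂ K A)

instance commHom_tri₁₂ : CommHom (tri₁ K A) (tri₂ K A) := commHom_includeLeft_includeRight _ _

instance commHom_tri₁₃ : CommHom (tri₁ K A) (tri₃ K A) := commHom_includeLeft_includeRight _ _

instance commHom_tri₂₃ : CommHom (tri₂ K A) (tri₃ K A) := commHom_comp _ _ _

/-- `a ↦ a ⊗ 1 ⊗ 1 ⊗ 1`. -/
def quad₁ : A →ₐ[K] (A ⊗[K] A) ⊗[K] (A ⊗[K] A) :=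
  Algebra.TensorProduct.includeLeft.comp (two₁ K A)

/-- `a ↦ 1 ⊗ a ⊗ 1 ⊗ 1`. -/
def quad₂ : A →ₐ[K] (A ⊗[K] A) ⊗[K] (A ⊗[K] A) :=
  Algebra.TensorProduct.includeLeft.comp (two₂ K A)

/-- `a ↦ 1 ⊗ 1 ⊗ a ⊗ 1`. -/
def quad₃ : A →ₐ[K] (A ⊗[K] A) ⊗[K] (A ⊗[K] A) :=
  Algebra.TensorProduct.includeRight.comp (two₁ K A)

/-- `a ↦ 1 ⊗ 1 ⊗ 1 ⊗ a`. -/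
def quad₄ : A →ₐ[K] (A ⊗[K] A) ⊗[K] (A ⊗[K] A) :=
  Algebra.TensorProduct.includeRight.comp (two₂ K A)

instance commHom_quad₁₂ : CommHom (quad₁ K A) (quad₂ K A) := commHom_comp _ _ _

instance commHom_quad₁₃ : CommHom (quad₁ K A) (quad₃ K A) := commHom_includeLeft_includeRight _ _

instance commHom_quad₁₄ : CommHom (quad₁ K A) (quad₄ K A) := commHom_includeLeft_includeRight _ _

instance commHom_quad₂₃ : CommHom (quad₂ K A) (quad₃ K A) := commHom_includeLeft_includeRight _ _

instance commHom_quad₂₄ : CommHom (quad₂ K A) (quad₄ K A) := commHom_includeLeft_includeRight _ _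

instance commHom_quad₃₄ : CommHom (quad₃ K A) (quad₄ K A) := commHom_comp _ _ _

variable {K A}

@[simp]
theorem two₁_apply (a : A) : two₁ K A a = a ⊗ₜ 1 := rfl

@[simp]
theorem two₂_apply (a : A) : two₂ K A a = 1 ⊗ₜ a := rfl

@[simp]
theorem tri₁_apply (a : A) : tri₁ K A a = a ⊗ₜ (1 ⊗ₜ 1) := rfl

@[simp]
theorem tri₂_apply (a : A) : tri₂ K A a = 1 ⊗ₜ (a ⊗ₜ 1) := rfl

@[simp]
theorem tri₃_apply (a : A) : tri₃ K A a = 1 ⊗ₜ (1 ⊗ₜ a) := rfl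

@[simp]
theorem quad₁_apply (a : A) : quad₁ K A a = (a ⊗ₜ 1) ⊗ₜ (1 ⊗ₜ 1) := rfl

@[simp]
theorem quad₂_apply (a : A) : quad₂ K A a = (1 ⊗ₜ a) ⊗ₜ (1 ⊗ₜ 1) := rfl

@[simp]
theorem quad₃_apply (a : A) : quad₃ K A a = (1 ⊗ₜ 1) ⊗ₜ (a ⊗ₜ 1) := rfl

@[simp]
theorem quad₄_apply (a : A) : quad₄ K A a = (1 ⊗ₜ 1) ⊗ₜ (1 ⊗ₜ a) := rfl

/-- The standard legs are universal: through this lemma and `quadruple_quad`, identities between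
legs become identities in the tensor power itself. -/
theorem triple_tri (P : A ⊗[K] (A ⊗[K] A)) : triple (tri₁ K A) (tri₂ K A) (tri₃ K A) P = P := by
  induction P using induction₃ with
  | zero => simp
  | tmul x y z => simp
  | add s t hs ht => simp only [map_add, hs, ht]

theorem quadruple_quad (P : (A ⊗[K] A) ⊗[K] (A ⊗[K] A)) :
    quadruple (quad₁ K A) (quad₂ K A) (quad₃ K A) (quad₄ K A) P = P := by
  induction P using induction₄ with
  | zero => simp
  | tmul x y z w => simp
  | add s t hs ht => simp only [map_add, hs, ht]

end Legs

section Reverse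

variable (K A) in
/-- `x ⊗ y ⊗ z ↦ z ⊗ y ⊗ x`. -/
def reverse : A ⊗[K] (A ⊗[K] A) →ₐ[K] A ⊗[K] (A ⊗[K] A) := (permZXY K A).comp (permYXZ K A)

theorem reverse_tmul (x y z : A) :
    reverse K A (x ⊗ₜ (y ⊗ₜ z)) = z ⊗ₜ (y ⊗ₜ x) := rfl

variable {L : Type w} [Ring L] [Algebra K L] (f g h : A →ₐ[K] L) [CommHom f g]

theorem pair_swap (D : A ⊗[K] A) : pair f g (swap K A D) = pair g f D := by
  induction D with
  | zero => simp
  | tmul x y => simpa [swap_tmul] using (CommHom.comm y x : Commute (f y) (g x)).eq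
  | add s t hs ht => simp only [map_add, hs, ht]

theorem conv_swap (Δ : A →ₐ[K] A ⊗[K] A) :
    conv ((swap K A).toAlgHom.comp Δ) f g = conv Δ g f :=
  AlgHom.ext fun a => pair_swap f g (Δ a)

theorem triple_reverse [CommHom f h] [CommHom g h] (P : A ⊗[K] (A ⊗[K] A)) :
    triple f g h (reverse K A P) = triple h g f P := by
  induction P using induction₃ with
  | zero => simp
  | tmul x y z =>
    rw [reverse_tmul, triple_tmul, triple_tmul, commute_swap_left (f := f) (g := g),
      (CommHom.comm z x : Commute (f z) (h x)).eq, commute_swap_left (f := g) (g := h)]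
  | add s t hs ht => simp only [map_add, hs, ht]

variable {f g h} {f' g' h' : A →ₐ[K] L} [CommHom f' g']

theorem conv_swap_of_eq (Δ : A →ₐ[K] A ⊗[K] A) (hf : f = f') (hg : g = g') :
    conv ((swap K A).toAlgHom.comp Δ) f g = conv Δ g' f' := by
  subst hf hg
  exact conv_swap _ _ _

end Reverse

namespace QuasiBialgebra

variable (Q : QuasiBialgebra K A)

section Cop

variable {L : Type w} [Ring L] [Algebra K L] {f g h f' g' h' : A →ₐ[K] L} [CommHom f g]
  [CommHom f h] [CommHom g h] [CommHom f' g'] [CommHom f' h'] [CommHom g' h']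

theorem triple_reverse_inv (hf : f = f') (hg : g = g') (hh : h = h') :
    triple f g h (reverse K A ((Q.Φ⁻¹ : (A ⊗[K] (A ⊗[K] A))ˣ) : A ⊗[K] (A ⊗[K] A))) =
      ((Q.phi h' g' f')⁻¹ : Lˣ) := by
  subst hf hg hh
  rw [triple_reverse, val_phi_inv]

end Cop

/-- The coopposite quasi-bialgebra. -/
def cop : QuasiBialgebra K A where
  Δ := (swap K A).toAlgHom.comp Q.Δ
  ε := Q.ε
  Φ := Units.map (reverse K A : A ⊗[K] (A ⊗[K] A) →* A ⊗[K] (A ⊗[K] A)) Q.Φ⁻¹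
  quasi_coassoc a := by
    have h := Q.conv_assoc (tri₃ K A) (tri₂ K A) (tri₁ K A) a
    rw [← triple_tri (idDelta _ _), ← triple_tri (deltaId _ _), ← pair_conv_right, ← pair_conv_left,
      ← triple_tri ((Units.map _ _ : (A ⊗[K] (A ⊗[K] A))ˣ) : A ⊗[K] (A ⊗[K] A))]
    simp only [Units.coe_map, MonoidHom.coe_coe]
    rw [Q.triple_reverse_inv rfl rfl rfl, ← conv_apply, ← conv_apply, 
      conv_swap_of_eq Q.Δ rfl (conv_swap _ _ _), conv_swap_of_eq Q.Δ (conv_swap _ _ _) rfl,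
      Units.mul_inv_eq_iff_eq_mul, mul_assoc, h, Units.inv_mul_cancel_left]
  pentagon := by
    -- Reversing the legs and inverting both sides maps the pentagon to itself.
    have h := congrArg (fun x : ((A ⊗[K] A) ⊗[K] (A ⊗[K] A))ˣ => ((x⁻¹ : ((A ⊗[K] A) ⊗[K] (A ⊗[K] A))ˣ) :
        (A ⊗[K] A) ⊗[K] (A ⊗[K] A)))
      (Q.phi_pentagon (quad₄ K A) (quad₃ K A) (quad₂ K A) (quad₁ K A))
    simp only [mul_inv_rev, Units.val_mul] at h
    rw [← quadruple_quad (idIdDelta _ _ * _), ← quadruple_quad (_ * leg123 K A _)]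
    simp only [map_mul, quadruple_idIdDelta, quadruple_deltaIdId, quadruple_leg234,
      quadruple_leg123, quadruple_idDeltaId, Units.coe_map, MonoidHom.coe_coe]
    rw [Q.triple_reverse_inv rfl rfl (conv_swap _ _ _),
      Q.triple_reverse_inv (conv_swap _ _ _) rfl rfl,
      Q.triple_reverse_inv rfl (conv_swap _ _ _) rfl,
      Q.triple_reverse_inv rfl rfl rfl, Q.triple_reverse_inv rfl rfl rfl, h]
    simp only [mul_assoc]
  counit_left a := by
    have key : (epsId Q.ε).comp (swap K A).toAlgHom = idEps Q.ε := by
      ext <;> simp [epsId_tmul, idEps_tmul, swap_tmul]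
    exact (congrArg (fun φ : A ⊗[K] A →ₐ[K] A => φ (Q.Δ a)) key).trans (Q.counit_right a)
  counit_right a := by
    have key : (idEps Q.ε).comp (swap K A).toAlgHom = epsId Q.ε := by
      ext <;> simp [epsId_tmul, idEps_tmul, swap_tmul]
    exact (congrArg (fun φ : A ⊗[K] A →ₐ[K] A => φ (Q.Δ a)) key).trans (Q.counit_left a)
  counit_associator := by
    have key (P : A ⊗[K] (A ⊗[K] A)) :
        idEpsId Q.ε (reverse K A P) = swap K A (idEpsId Q.ε P) := by
      induction P using induction₃ with
      | zero => simp
      | tmul x y z => simp [idEpsId_tmul, reverse_tmul, swap_tmul]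
      | add s t hs ht => simp only [map_add, hs, ht]
    have h1 : Units.map (idEpsId Q.ε : A ⊗[K] (A ⊗[K] A) →* A ⊗[K] A) Q.Φ = 1 :=
      Units.ext Q.counit_associator
    have h2 : idEpsId Q.ε ((Q.Φ⁻¹ : (A ⊗[K] (A ⊗[K] A))ˣ) : A ⊗[K] (A ⊗[K] A)) = 1 := by
      have := congrArg Units.val (congrArg Inv.inv h1)
      rwa [← map_inv, inv_one] at this
    simp only [Units.coe_map, MonoidHom.coe_coe]
    rw [key, h2, map_one]

section Cop

variable {L : Type w} [Ring L] [Algebra K L] {f g h f' g' h' : A →ₐ[K] L} [CommHom f g]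
  [CommHom f h] [CommHom g h] [CommHom f' g'] [CommHom f' h'] [CommHom g' h']

theorem conv_cop (hf : f = f') (hg : g = g') : conv Q.cop.Δ f g = conv Q.Δ g' f'  :=
  conv_swap_of_eq Q.Δ hf hg

theorem phi_cop (hf : f = f') (hg : g = g') (hh : h = h') :
    Q.cop.phi f g h = (Q.phi h' g' f')⁻¹ :=
  Units.ext (Q.triple_reverse_inv hf hg hh)

end Cop

end QuasiBialgebra

end

/-! ### Words in an antipode; antipode data over a homomorphism and their uniqueness. -/

section

variable {K : Type u} {A : Type v} [Field K] [Ring A] [Algebra K A]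
variable {B : Type w} [Ring B] [Algebra K B]

section Words

variable (p q r s : A →ₗ[K] B) (a b c : B)

/-- `x ⊗ y ↦ p x * a * q y`. -/
def word₂ : A ⊗[K] A →ₗ[K] B :=
  LinearMap.mul' K B ∘ₗ TensorProduct.map (LinearMap.mulRight K a ∘ₗ p) q

/-- `x ⊗ y ⊗ z ↦ p x * a * q y * b * r z`. -/
def word₃ : A ⊗[K] (A ⊗[K] A) →ₗ[K] B :=
  LinearMap.mul' K B ∘ₗ TensorProduct.map (LinearMap.mulRight K a ∘ₗ p) (word₂ q r b)

/-- `x ⊗ y ⊗ z ⊗ w ↦ p x * a * q y * b * r z * c * s w`. -/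
def word₄ : (A ⊗[K] A) ⊗[K] (A ⊗[K] A) →ₗ[K] B :=
  LinearMap.mul' K B ∘ₗ TensorProduct.map (LinearMap.mulRight K b ∘ₗ word₂ p q a) (word₂ r s c)

variable {p q r s a b c}

theorem word₂_tmul (x y : A) : word₂ p q a (x ⊗ₜ y) = p x * a * q y := rfl

theorem word₃_tmul (x y z : A) :
    word₃ p q r a b (x ⊗ₜ (y ⊗ₜ z)) = p x * a * q y * b * r z := by
  change p x * a * (q y * b * r z) = _
  simp only [mul_assoc]

theorem word₄_tmul (x y z w : A) :
    word₄ p q r s a b c ((x ⊗ₜ y) ⊗ₜ (z ⊗ₜ w)) = p x * a * q y * b * r z * c * s w := by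
  change p x * a * q y * b * (r z * c * s w) = _
  simp only [mul_assoc]

variable (hp : ∀ x y, p (x * y) = p x * p y) (hp' : ∀ x y, p (x * y) = p y * p x)
  (hq : ∀ x y, q (x * y) = q x * q y) (hq' : ∀ x y, q (x * y) = q y * q x)
  (hr : ∀ x y, r (x * y) = r x * r y) (hr' : ∀ x y, r (x * y) = r y * r x)
  (hs : ∀ x y, s (x * y) = s x * s y) (Q : QuasiBialgebra K A)

-- As `p` reverses products and `q` preserves them, a left factor `x₁ ⊗ x₂` ends up around `a`, as
-- `p(x₁) a q(x₂) = ε(x) a`. The next six lemmas are the same for other positions; for right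
-- factors, the first of the two maps preserves products and the second reverses them.
include hp' hq in
theorem leftEq_word₃₁₂ (h : ∀ x, word₂ p q a (Q.Δ x) = Q.ε x • a) :
    LeftEq (word₃ p q r a b) (conv Q.Δ (tri₁ K A) (tri₂ K A)) (Q.unitHom _) := by
  intro x T
  induction T using induction₃ with
  | zero => simp
  | add s t hs ht => simp only [mul_add, map_add, hs, ht]
  | tmul y z w =>
    have key (D : A ⊗[K] A) : word₃ p q r a b (pair (tri₁ K A) (tri₂ K A) D * y ⊗ₜ (z ⊗ₜ w)) =
        p y * word₂ p q a D * q z * b * r w := by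
      induction D with
      | zero => simp
      | add s t hs ht => simp only [mul_add, add_mul, map_add, hs, ht]
      | tmul d e => simp [word₃_tmul, word₂_tmul, hp', hq, mul_assoc]
    rw [conv_apply, key, h, Q.unitHom_apply, ← Algebra.smul_def, map_smul, word₃_tmul]
    simp

include hq' hr in
theorem leftEq_word₃₂₃ (h : ∀ x, word₂ q r b (Q.Δ x) = Q.ε x • b) :
    LeftEq (word₃ p q r a b) (conv Q.Δ (tri₂ K A) (tri₃ K A)) (Q.unitHom _) := by
  intro x T
  induction T using induction₃ with
  | zero => simp
  | add s t hs ht => simp only [mul_add, map_add, hs, ht]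
  | tmul y z w =>
    have key (D : A ⊗[K] A) : word₃ p q r a b (pair (tri₂ K A) (tri₃ K A) D * y ⊗ₜ (z ⊗ₜ w)) =
        p y * a * q z * word₂ q r b D * r w := by
      induction D with
      | zero => simp
      | add s t hs ht => simp only [mul_add, add_mul, map_add, hs, ht]
      | tmul d e => simp [word₃_tmul, word₂_tmul, hq', hr, mul_assoc]
    rw [conv_apply, key, h, Q.unitHom_apply, ← Algebra.smul_def, map_smul, word₃_tmul]
    simp

include hp hq' in
theorem rightEq_word₃₁₂ (h : ∀ x, word₂ p q a (Q.Δ x) = Q.ε x • a) :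
    RightEq (word₃ p q r a b) (conv Q.Δ (tri₁ K A) (tri₂ K A)) (Q.unitHom _) := by
  intro x T
  induction T using induction₃ with
  | zero => simp
  | add s t hs ht => simp only [add_mul, map_add, hs, ht]
  | tmul y z w =>
    have key (D : A ⊗[K] A) : word₃ p q r a b (y ⊗ₜ (z ⊗ₜ w) * pair (tri₁ K A) (tri₂ K A) D) =
        p y * word₂ p q a D * q z * b * r w := by
      induction D with
      | zero => simp
      | add s t hs ht => simp only [mul_add, add_mul, map_add, hs, ht]
      | tmul d e => simp [word₃_tmul, word₂_tmul, hp, hq', mul_assoc]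
    rw [conv_apply, key, h, Q.unitHom_apply, ← Algebra.commutes, ← Algebra.smul_def, map_smul,
      word₃_tmul]
    simp

include hq hr' in
theorem rightEq_word₃₂₃ (h : ∀ x, word₂ q r b (Q.Δ x) = Q.ε x • b) :
    RightEq (word₃ p q r a b) (conv Q.Δ (tri₂ K A) (tri₃ K A)) (Q.unitHom _) := by
  intro x T
  induction T using induction₃ with
  | zero => simp
  | add s t hs ht => simp only [add_mul, map_add, hs, ht]
  | tmul y z w =>
    have key (D : A ⊗[K] A) : word₃ p q r a b (y ⊗ₜ (z ⊗ₜ w) * pair (tri₂ K A) (tri₃ K A) D) =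
        p y * a * q z * word₂ q r b D * r w := by
      induction D with
      | zero => simp
      | add s t hs ht => simp only [mul_add, add_mul, map_add, hs, ht]
      | tmul d e => simp [word₃_tmul, word₂_tmul, hq, hr', mul_assoc]
    rw [conv_apply, key, h, Q.unitHom_apply, ← Algebra.commutes, ← Algebra.smul_def, map_smul,
      word₃_tmul]
    simp

include hp' hq in
theorem leftEq_word₄₁₂ (h : ∀ x, word₂ p q a (Q.Δ x) = Q.ε x • a) :
    LeftEq (word₄ p q r s a b c) (conv Q.Δ (quad₁ K A) (quad₂ K A)) (Q.unitHom _) := by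
  intro x T
  induction T using induction₄ with
  | zero => simp
  | add s t hs ht => simp only [mul_add, map_add, hs, ht]
  | tmul y z w v =>
    have key (D : A ⊗[K] A) : word₄ p q r s a b c
        (pair (quad₁ K A) (quad₂ K A) D * (y ⊗ₜ z) ⊗ₜ (w ⊗ₜ v)) =
        p y * word₂ p q a D * q z * b * r w * c * s v := by
      induction D with
      | zero => simp
      | add s t hs ht => simp only [mul_add, add_mul, map_add, hs, ht]
      | tmul d e => simp [word₄_tmul, word₂_tmul, hp', hq, mul_assoc]
    rw [conv_apply, key, h, Q.unitHom_apply, ← Algebra.smul_def, map_smul, word₄_tmul]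
    simp

include hr' hs in
theorem leftEq_word₄₃₄ (h : ∀ x, word₂ r s c (Q.Δ x) = Q.ε x • c) :
    LeftEq (word₄ p q r s a b c) (conv Q.Δ (quad₃ K A) (quad₄ K A)) (Q.unitHom _) := by
  intro x T
  induction T using induction₄ with
  | zero => simp
  | add s t hs ht => simp only [mul_add, map_add, hs, ht]
  | tmul y z w v =>
    have key (D : A ⊗[K] A) : word₄ p q r s a b c
        (pair (quad₃ K A) (quad₄ K A) D * (y ⊗ₜ z) ⊗ₜ (w ⊗ₜ v)) =
        p y * a * q z * b * r w * word₂ r s c D * s v := by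
      induction D with
      | zero => simp
      | add s t hs ht => simp only [mul_add, add_mul, map_add, hs, ht]
      | tmul d e => simp [word₄_tmul, word₂_tmul, hr', hs, mul_assoc]
    rw [conv_apply, key, h, Q.unitHom_apply, ← Algebra.smul_def, map_smul, word₄_tmul]
    simp

include hq hr' in
theorem rightEq_word₄₂₃ (h : ∀ x, word₂ q r b (Q.Δ x) = Q.ε x • b) :
    RightEq (word₄ p q r s a b c) (conv Q.Δ (quad₂ K A) (quad₃ K A)) (Q.unitHom _) := by
  intro x T
  induction T using induction₄ with
  | zero => simp
  | add s t hs ht => simp only [add_mul, map_add, hs, ht]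
  | tmul y z w v =>
    have key (D : A ⊗[K] A) : word₄ p q r s a b c
        ((y ⊗ₜ z) ⊗ₜ (w ⊗ₜ v) * pair (quad₂ K A) (quad₃ K A) D) =
        p y * a * q z * word₂ q r b D * r w * c * s v := by
      induction D with
      | zero => simp
      | add s t hs ht => simp only [mul_add, add_mul, map_add, hs, ht]
      | tmul d e => simp [word₄_tmul, word₂_tmul, hq, hr', mul_assoc]
    rw [conv_apply, key, h, Q.unitHom_apply, ← Algebra.commutes, ← Algebra.smul_def, map_smul,
      word₄_tmul]
    simp

end Words

/-- Antipode data `(S, α, β)` over an algebra homomorphism `f : A → B`: for `f = id` this is the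
antipode structure of a quasi-Hopf algebra. -/
structure AntipodeData (Q : QuasiBialgebra K A) (f : A →ₐ[K] B) where
  S : A →ₗ[K] B
  S_one : S 1 = 1
  S_mul : ∀ x y, S (x * y) = S y * S x
  α : B
  β : B
  ev : ∀ x, word₂ S f.toLinearMap α (Q.Δ x) = Q.ε x • α
  coev : ∀ x, word₂ f.toLinearMap S β (Q.Δ x) = Q.ε x • β
  snake₁ : word₃ f.toLinearMap S f.toLinearMap β α (Q.Φ : A ⊗[K] (A ⊗[K] A)) = 1
  snake₂ : word₃ S f.toLinearMap S α β
    ((Q.Φ⁻¹ : (A ⊗[K] (A ⊗[K] A))ˣ) : A ⊗[K] (A ⊗[K] A)) = 1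

namespace AntipodeData

variable {Q : QuasiBialgebra K A} {f : A →ₐ[K] B} (T₂ T₁ : AntipodeData Q f)

/-- The element relating two antipode data over the same homomorphism. -/
def compare : B := word₃ T₂.S f.toLinearMap T₁.S T₂.α T₁.β
  ((Q.Φ⁻¹ : (A ⊗[K] (A ⊗[K] A))ˣ) : A ⊗[K] (A ⊗[K] A))

/-- Evaluate quasi-coassociativity for `Φ⁻¹` on the word of `compare`. On one side the last two legs
of `x` cancel against `T₁.β`, and the first comes out on the left as `T₂.S x`; on the other side the
first two cancel against `T₂.α`, and the last comes out on the right as `T₁.S x`. -/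
theorem S_mul_compare (x : A) : T₂.S x * compare T₂ T₁ = compare T₂ T₁ * T₁.S x := by
  set E := word₃ T₂.S f.toLinearMap T₁.S T₂.α T₁.β with hE
  have h12 : LeftEq E (conv Q.Δ (tri₁ K A) (tri₂ K A)) (Q.unitHom _) :=
    leftEq_word₃₁₂ T₂.S_mul (map_mul f) Q T₂.ev
  have h23 : RightEq E (conv Q.Δ (tri₂ K A) (tri₃ K A)) (Q.unitHom _) :=
    rightEq_word₃₂₃ (map_mul f) T₁.S_mul Q T₁.coev
  have h1 := h12.conv₁ Q.Δ (f := tri₃ K A)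
  have h2 := h23.conv₂ Q.Δ (f := tri₁ K A)
  rw [Q.conv_unitHom_left] at h1
  rw [Q.conv_unitHom_right] at h2
  have h := congrArg E (Q.conv_assoc_symm (f := tri₁ K A) (g := tri₂ K A) (h := tri₃ K A) x)
  rw [h1, h2, Q.val_phi_inv, triple_tri] at h
  have e1 (P : A ⊗[K] (A ⊗[K] A)) : E (P * tri₁ K A x) = T₂.S x * E P := by
    induction P using induction₃ with
    | zero => simp
    | tmul y z w => simp [hE, word₃_tmul, T₂.S_mul, mul_assoc]
    | add s t hs ht => simp only [map_add, mul_add, add_mul, hs, ht]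
  have e2 (P : A ⊗[K] (A ⊗[K] A)) : E (tri₃ K A x * P) = E P * T₁.S x := by
    induction P using induction₃ with
    | zero => simp
    | tmul y z w => simp [hE, word₃_tmul, T₁.S_mul, mul_assoc]
    | add s t hs ht => simp only [map_add, mul_add, add_mul, hs, ht]
  rw [e1, e2] at h
  exact h

/-- In the four-letter word with `T₂.α`, `T₁.β`, `T₁.α` between the letters, `Φ⁻¹` on the first
three legs gives the left side. By `eval_phi_inv` it may be replaced by `Φ` on the last three, where
`T₁.snake₁` leaves `T₂.α`. -/
theorem compare_mul_α : compare T₂ T₁ * T₁.α = T₂.α := by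
  set E := word₄ T₂.S f.toLinearMap T₁.S f.toLinearMap T₂.α T₁.β T₁.α with hE
  have h := Q.eval_phi_inv (E := E) (a := quad₁ K A) (b := quad₂ K A) (c := quad₃ K A)
    (d := quad₄ K A) (leftEq_word₄₁₂ T₂.S_mul (map_mul f) Q T₂.ev)
    (leftEq_word₄₃₄ T₁.S_mul (map_mul f) Q T₁.ev) (rightEq_word₄₂₃ (map_mul f) T₁.S_mul Q T₁.coev)
  have e1 (P : A ⊗[K] (A ⊗[K] A)) : E (triple (quad₁ K A) (quad₂ K A) (quad₃ K A) P) =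
      word₃ T₂.S f.toLinearMap T₁.S T₂.α T₁.β P * T₁.α := by
    induction P using induction₃ with
    | zero => simp
    | tmul y z w => simp [hE, word₄_tmul, word₃_tmul]
    | add s t hs ht => simp only [map_add, add_mul, hs, ht]
  have e2 (P : A ⊗[K] (A ⊗[K] A)) : E (triple (quad₂ K A) (quad₃ K A) (quad₄ K A) P) =
      T₂.α * word₃ f.toLinearMap T₁.S f.toLinearMap T₁.β T₁.α P := by
    induction P using induction₃ with
    | zero => simp
    | tmul y z w => simp [hE, word₄_tmul, word₃_tmul, T₂.S_one, mul_assoc]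
    | add s t hs ht => simp only [map_add, mul_add, hs, ht]
  rwa [Q.val_phi_inv, e1, Q.val_phi, e2, T₁.snake₁, mul_one] at h

theorem mul_word₃ {v : B} (hS : ∀ x, T₂.S x * v = v * T₁.S x) (b : B) (P : A ⊗[K] (A ⊗[K] A)) :
    v * word₃ T₁.S f.toLinearMap T₁.S T₁.α b P =
      word₃ T₂.S f.toLinearMap T₁.S (v * T₁.α) b P := by
  induction P using induction₃ with
  | zero => simp
  | tmul y z w => simp only [word₃_tmul, ← mul_assoc, hS]
  | add s t hs ht => simp only [map_add, mul_add, hs, ht]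

/-- Write `v = v · 1`, expand `1` by `T₁.snake₂`, and move `v` past the first antipode: only `v *
T₁.α` remains. This is the uniqueness used both for invertibility and for the coproduct formula. -/
theorem eq_of_mul_α_eq {v w : B} (hv : ∀ x, T₂.S x * v = v * T₁.S x)
    (hw : ∀ x, T₂.S x * w = w * T₁.S x) (h : v * T₁.α = w * T₁.α) : v = w := by
  rw [← mul_one v, ← mul_one w, ← T₁.snake₂, T₂.mul_word₃ T₁ hv, T₂.mul_word₃ T₁ hw, h]

theorem compare_mul_compare : compare T₁ T₂ * compare T₂ T₁ = 1 := by
  refine T₁.eq_of_mul_α_eq T₁ (fun x => ?_) (fun x => by simp) ?_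
  · rw [← mul_assoc, S_mul_compare, mul_assoc, S_mul_compare, mul_assoc]
  · rw [mul_assoc, compare_mul_α, compare_mul_α, one_mul]

/-- `compare` as a unit. -/
def compareUnit : Bˣ where
  val := compare T₂ T₁
  inv := compare T₁ T₂
  val_inv := compare_mul_compare T₁ T₂
  inv_val := compare_mul_compare T₂ T₁

end AntipodeData

end

/-! ### Transport of antipode data; `γ` and `δ` as evaluation and coevaluation over the coproduct.
-/

section

variable {K : Type u} {A : Type v} [Field K] [Ring A] [Algebra K A]
variable {B : Type w} [Ring B] [Algebra K B] {C : Type w'} [Ring C] [Algebra K C]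

/-- Transport of antipode data along an algebra homomorphism. -/
def AntipodeData.map {Q : QuasiBialgebra K A} {f : A →ₐ[K] B} (T : AntipodeData Q f)
    (j : B →ₐ[K] C) : AntipodeData Q (j.comp f) where
  S := j.toLinearMap ∘ₗ T.S
  S_one := by simp [T.S_one]
  S_mul x y := by simp [T.S_mul]
  α := j T.α
  β := j T.β
  ev x := by
    have key : word₂ (j.toLinearMap ∘ₗ T.S) (j.comp f).toLinearMap (j T.α) =
        j.toLinearMap ∘ₗ word₂ T.S f.toLinearMap T.α := by
      ext x y
      simp [word₂_tmul]
    rw [key, LinearMap.comp_apply, T.ev, map_smul]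
    rfl
  coev x := by
    have key : word₂ (j.comp f).toLinearMap (j.toLinearMap ∘ₗ T.S) (j T.β) =
        j.toLinearMap ∘ₗ word₂ f.toLinearMap T.S T.β := by
      ext x y
      simp [word₂_tmul]
    rw [key, LinearMap.comp_apply, T.coev, map_smul]
    rfl
  snake₁ := by
    have key : word₃ (j.comp f).toLinearMap (j.toLinearMap ∘ₗ T.S) (j.comp f).toLinearMap (j T.β)
        (j T.α) = j.toLinearMap ∘ₗ word₃ f.toLinearMap T.S f.toLinearMap T.β T.α := by
      ext x y z
      simp [word₃_tmul]
    rw [key, LinearMap.comp_apply, T.snake₁]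
    simp
  snake₂ := by
    have key : word₃ (j.toLinearMap ∘ₗ T.S) (j.comp f).toLinearMap (j.toLinearMap ∘ₗ T.S) (j T.α)
        (j T.β) = j.toLinearMap ∘ₗ word₃ T.S f.toLinearMap T.S T.α T.β := by
      ext x y z
      simp [word₃_tmul]
    rw [key, LinearMap.comp_apply, T.snake₂]
    simp

namespace QuasiHopfAlgebra

variable (H : QuasiHopfAlgebra K A)

/-- The antipode data over the identity given by a quasi-Hopf structure. -/
def antipodeData : AntipodeData H.toQuasiBialgebra (AlgHom.id K A) where
  S := H.S.toLinearMap
  S_one := H.S_one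
  S_mul := H.S_mul
  α := H.α
  β := H.β
  ev x := by
    have key : word₂ H.S.toLinearMap (AlgHom.id K A).toLinearMap H.α = evMap H.S H.α := by
      ext x y
      simp [word₂_tmul, evMap_tmul]
    rw [key, H.antipode_left]
  coev x := by
    have key : word₂ (AlgHom.id K A).toLinearMap H.S.toLinearMap H.β = coevMap H.S H.β := by
      ext x y
      simp [word₂_tmul, coevMap_tmul]
    rw [key, H.antipode_right]
  snake₁ := by
    have key : word₃ (AlgHom.id K A).toLinearMap H.S.toLinearMap (AlgHom.id K A).toLinearMap
        H.β H.α = dualMap₁ H.S H.α H.β := by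
      ext x y z
      simp [word₃_tmul, dualMap₁_tmul]
    rw [key, H.duality₁]
  snake₂ := by
    have key : word₃ H.S.toLinearMap (AlgHom.id K A).toLinearMap H.S.toLinearMap
        H.α H.β = dualMap₂ H.S H.α H.β := by
      ext x y z
      simp [word₃_tmul, dualMap₂_tmul]
    rw [key, H.duality₂]

/-- `x ⊗ y ⊗ z ⊗ w ↦ x β S(w) ⊗ y β S(z)`. -/
def deltaMap : (A ⊗[K] A) ⊗[K] (A ⊗[K] A) →ₗ[K] A ⊗[K] A :=
  TensorProduct.map (coevMap H.S H.β) (coevMap H.S H.β) ∘ₗ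
    (TensorProduct.tensorTensorTensorComm K A A A A).toLinearMap ∘ₗ
    TensorProduct.map LinearMap.id (swap K A).toLinearMap

theorem deltaMap_tmul (x y z w : A) : H.deltaMap ((x ⊗ₜ y) ⊗ₜ (z ⊗ₜ w)) =
    (x * H.β * H.S w) ⊗ₜ (y * H.β * H.S z) := rfl

theorem SS_tmul (x y : A) : H.SS (x ⊗ₜ y) = H.S x ⊗ₜ H.S y := rfl

theorem SS_one : H.SS 1 = 1 := by
  rw [Algebra.TensorProduct.one_def, SS_tmul, H.S_one]

theorem SS_mul (C D : A ⊗[K] A) : H.SS (C * D) = H.SS D * H.SS C := by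
  induction C with
  | zero => simp
  | add s t hs ht => simp only [map_add, add_mul, mul_add, hs, ht]
  | tmul x y =>
    induction D with
    | zero => simp
    | add s t hs ht => simp only [map_add, add_mul, mul_add, hs, ht]
    | tmul z w => simp [SS_tmul, H.S_mul]

section Kill

/-- Outer factors are absorbed as right multiplication of the word. Left multiplication thus remains
available for evaluations: the inner pair of legs `2, 3` and the outer pair `1, 4`. -/
theorem gammaMap_mul (C D : A ⊗[K] A) (G : (A ⊗[K] A) ⊗[K] (A ⊗[K] A)) :
    H.SS (swap K A C) * gammaMap H.S H.α G * D =
      gammaMap H.S H.α (G * (pair (quad₁ K A) (quad₂ K A) C * pair (quad₃ K A) (quad₄ K A) D)) := by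
  induction C with
  | zero => simp
  | add s t hs ht => simp only [map_add, add_mul, mul_add, hs, ht]
  | tmul x y =>
    induction D with
    | zero => simp
    | add s t hs ht => simp only [map_add, mul_add, hs, ht]
    | tmul z w =>
      induction G using induction₄ with
      | zero => simp
      | add s t hs ht => simp only [map_add, add_mul, mul_add, hs, ht]
      | tmul a b c d => simp [SS_tmul, swap_tmul, gammaMap_tmul, H.S_mul, mul_assoc]

theorem mul_deltaMap (C D : A ⊗[K] A) (G : (A ⊗[K] A) ⊗[K] (A ⊗[K] A)) :
    C * H.deltaMap G * H.SS (swap K A D) =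
      H.deltaMap (pair (quad₁ K A) (quad₂ K A) C * pair (quad₃ K A) (quad₄ K A) D * G) := by
  induction C with
  | zero => simp
  | add s t hs ht => simp only [map_add, add_mul, hs, ht]
  | tmul x y =>
    induction D with
    | zero => simp
    | add s t hs ht => simp only [map_add, add_mul, mul_add, hs, ht]
    | tmul z w =>
      induction G using induction₄ with
      | zero => simp
      | add s t hs ht => simp only [map_add, add_mul, mul_add, hs, ht]
      | tmul a b c d => simp [SS_tmul, swap_tmul, deltaMap_tmul, H.S_mul, mul_assoc]

theorem leftEq_gammaMap₂₃ : LeftEq (gammaMap H.S H.α) (conv H.Δ (quad₂ K A) (quad₃ K A))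
    (H.unitHom _) := by
  intro x T
  induction T using induction₄ with
  | zero => simp
  | add s t hs ht => simp only [mul_add, map_add, hs, ht]
  | tmul y z w v =>
    have key (D : A ⊗[K] A) : gammaMap H.S H.α
        (pair (quad₂ K A) (quad₃ K A) D * (y ⊗ₜ z) ⊗ₜ (w ⊗ₜ v)) =
        (H.S z * evMap H.S H.α D * w) ⊗ₜ (H.S y * H.α * v) := by
      induction D with
      | zero => simp
      | add s t hs ht => simp only [mul_add, add_mul, map_add, hs, ht, TensorProduct.add_tmul]
      | tmul d e => simp [gammaMap_tmul, evMap_tmul, H.S_mul, mul_assoc]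
    rw [conv_apply, key, H.antipode_left, H.unitHom_apply, ← Algebra.smul_def, map_smul,
      gammaMap_tmul]
    simp [TensorProduct.smul_tmul']

theorem leftEq_gammaMap₁₄ : LeftEq (gammaMap H.S H.α) (conv H.Δ (quad₁ K A) (quad₄ K A))
    (H.unitHom _) := by
  intro x T
  induction T using induction₄ with
  | zero => simp
  | add s t hs ht => simp only [mul_add, map_add, hs, ht]
  | tmul y z w v =>
    have key (D : A ⊗[K] A) : gammaMap H.S H.α
        (pair (quad₁ K A) (quad₄ K A) D * (y ⊗ₜ z) ⊗ₜ (w ⊗ₜ v)) =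
        (H.S z * H.α * w) ⊗ₜ (H.S y * evMap H.S H.α D * v) := by
      induction D with
      | zero => simp
      | add s t hs ht => simp only [mul_add, add_mul, map_add, hs, ht, TensorProduct.tmul_add]
      | tmul d e => simp [gammaMap_tmul, evMap_tmul, H.S_mul, mul_assoc]
    rw [conv_apply, key, H.antipode_left, H.unitHom_apply, ← Algebra.smul_def, map_smul,
      gammaMap_tmul]
    simp

theorem rightEq_deltaMap₂₃ : RightEq H.deltaMap (conv H.Δ (quad₂ K A) (quad₃ K A))
    (H.unitHom _) := by
  intro x T
  induction T using induction₄ with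
  | zero => simp
  | add s t hs ht => simp only [add_mul, map_add, hs, ht]
  | tmul y z w v =>
    have key (D : A ⊗[K] A) : H.deltaMap
        ((y ⊗ₜ z) ⊗ₜ (w ⊗ₜ v) * pair (quad₂ K A) (quad₃ K A) D) =
        (y * H.β * H.S v) ⊗ₜ (z * coevMap H.S H.β D * H.S w) := by
      induction D with
      | zero => simp
      | add s t hs ht => simp only [mul_add, add_mul, map_add, hs, ht, TensorProduct.tmul_add]
      | tmul d e => simp [deltaMap_tmul, coevMap_tmul, H.S_mul, mul_assoc]
    rw [conv_apply, key, H.antipode_right, H.unitHom_apply, ← Algebra.commutes,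
      ← Algebra.smul_def, map_smul, deltaMap_tmul]
    simp

theorem rightEq_deltaMap₁₄ : RightEq H.deltaMap (conv H.Δ (quad₁ K A) (quad₄ K A))
    (H.unitHom _) := by
  intro x T
  induction T using induction₄ with
  | zero => simp
  | add s t hs ht => simp only [add_mul, map_add, hs, ht]
  | tmul y z w v =>
    have key (D : A ⊗[K] A) : H.deltaMap
        ((y ⊗ₜ z) ⊗ₜ (w ⊗ₜ v) * pair (quad₁ K A) (quad₄ K A) D) =
        (y * coevMap H.S H.β D * H.S v) ⊗ₜ (z * H.β * H.S w) := by
      induction D with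
      | zero => simp
      | add s t hs ht => simp only [mul_add, add_mul, map_add, hs, ht, TensorProduct.add_tmul]
      | tmul d e => simp [deltaMap_tmul, coevMap_tmul, H.S_mul, mul_assoc]
    rw [conv_apply, key, H.antipode_right, H.unitHom_apply, ← Algebra.commutes,
      ← Algebra.smul_def, map_smul, deltaMap_tmul]
    simp [TensorProduct.smul_tmul']

end Kill

/-- The associator word defining `γ`. -/
def gammaWord : (A ⊗[K] A) ⊗[K] (A ⊗[K] A) :=
  leg234 K A H.Φinv * idIdDelta H.Δ (H.Φ : A ⊗[K] (A ⊗[K] A))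

/-- The associator word defining `δ`. -/
def deltaWord : (A ⊗[K] A) ⊗[K] (A ⊗[K] A) :=
  deltaIdId H.Δ (H.Φ : A ⊗[K] (A ⊗[K] A)) * leg123 K A H.Φinv

/-- The coevaluation element dual to `γ`. -/
def δ : A ⊗[K] A := H.deltaMap H.deltaWord

section

variable {L : Type w} [Ring L] [Algebra K L] {a b c d : A →ₐ[K] L} [CommHom a b] [CommHom a c]
  [CommHom a d] [CommHom b c] [CommHom b d] [CommHom c d]

theorem quadruple_gammaWord : quadruple a b c d H.gammaWord =
    ↑((H.phi b c d)⁻¹ * H.phi a b (conv H.Δ c d)) := by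
  rw [gammaWord, map_mul, quadruple_leg234, quadruple_idIdDelta]
  rfl

theorem quadruple_deltaWord : quadruple a b c d H.deltaWord =
    ↑(H.phi (conv H.Δ a b) c d * (H.phi a b c)⁻¹) := by
  rw [deltaWord, map_mul, quadruple_leg123, quadruple_deltaIdId]
  rfl

end

/-- `S ⊗ S` composed with the opposite coproduct. -/
def prodS : A →ₗ[K] A ⊗[K] A := H.SS ∘ₗ (swap K A).toLinearMap ∘ₗ H.Δ.toLinearMap

theorem prodS_apply (x : A) : H.prodS x = H.SS (swap K A (H.Δ x)) := rfl

/-- The associators in the word of `γ` rebracket `(12)(34)` as `1((23)4)`. Evaluating the pair `23`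
leaves `14`, which is evaluated in turn. `prodS_coev` is the mirror image. -/
theorem prodS_ev (x : A) :
    word₂ H.prodS H.Δ.toLinearMap H.γ (H.Δ x) = H.ε x • H.γ := by
  have key (D : A ⊗[K] A) : word₂ H.prodS H.Δ.toLinearMap H.γ D = gammaMap H.S H.α
      (H.gammaWord * pair (conv H.Δ (quad₁ K A) (quad₂ K A))
        (conv H.Δ (quad₃ K A) (quad₄ K A)) D) := by
    induction D with
    | zero => simp
    | add s t hs ht => simp only [map_add, mul_add, hs, ht]
    | tmul y z => exact H.gammaMap_mul _ _ _
  have h1 : H.gammaWord * conv H.Δ (conv H.Δ (quad₁ K A) (quad₂ K A))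
      (conv H.Δ (quad₃ K A) (quad₄ K A)) x = conv H.Δ (quad₁ K A)
        (conv H.Δ (conv H.Δ (quad₂ K A) (quad₃ K A)) (quad₄ K A)) x * H.gammaWord := by
    rw [← quadruple_quad H.gammaWord, quadruple_gammaWord, Units.val_mul, mul_assoc,
      ← H.conv_assoc, ← mul_assoc, mul_conv₂ H.Δ H.conv_assoc_symm
        (fun y => H.commute_phi_inv y), mul_assoc]
  have k1 := H.leftEq_gammaMap₂₃.conv₁ H.Δ (f := quad₄ K A)
  rw [H.conv_unitHom_left] at k1
  have k2 := (k1.conv₂ H.Δ (f := quad₁ K A)).trans H.leftEq_gammaMap₁₄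
  rw [key, ← conv_apply, h1, k2, H.unitHom_apply, ← Algebra.smul_def, map_smul]
  rfl

theorem prodS_coev (x : A) :
    word₂ H.Δ.toLinearMap H.prodS H.δ (H.Δ x) = H.ε x • H.δ := by
  have key (D : A ⊗[K] A) : word₂ H.Δ.toLinearMap H.prodS H.δ D = H.deltaMap
      (pair (conv H.Δ (quad₁ K A) (quad₂ K A))
        (conv H.Δ (quad₃ K A) (quad₄ K A)) D * H.deltaWord) := by
    induction D with
    | zero => simp
    | add s t hs ht => simp only [map_add, add_mul, hs, ht]
    | tmul y z => exact H.mul_deltaMap _ _ _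
  have h1 : conv H.Δ (conv H.Δ (quad₁ K A) (quad₂ K A))
      (conv H.Δ (quad₃ K A) (quad₄ K A)) x * H.deltaWord = H.deltaWord * conv H.Δ
        (conv H.Δ (quad₁ K A) (conv H.Δ (quad₂ K A) (quad₃ K A))) (quad₄ K A) x := by
    rw [← quadruple_quad H.deltaWord, quadruple_deltaWord, Units.val_mul, ← mul_assoc,
      H.conv_assoc, mul_assoc, ← mul_conv₁ H.Δ H.conv_assoc_symm
        (fun y => H.commute_phi_inv y), mul_assoc]
  have k1 := H.rightEq_deltaMap₂₃.conv₂ H.Δ (f := quad₁ K A)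
  rw [H.conv_unitHom_right] at k1
  have k2 := (k1.conv₁ H.Δ (f := quad₄ K A)).trans H.rightEq_deltaMap₁₄
  rw [key, ← conv_apply, h1, k2, H.unitHom_apply, ← Algebra.commutes, ← Algebra.smul_def,
    map_smul]
  rfl

end QuasiHopfAlgebra

end

/-! ### The snake identities over the coproduct; `F` as a comparison element. -/

section

variable {K : Type u} {A : Type v} [Field K] [Ring A] [Algebra K A]

section Strands

variable {B : Type w} {C : Type w'} [Ring B] [Algebra K B] [Ring C] [Algebra K C]

theorem conv_comp (Δ : A →ₐ[K] A ⊗[K] A) (j : B →ₐ[K] C) (f g : A →ₐ[K] B) [CommHom f g] :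
    conv Δ (j.comp f) (j.comp g) = j.comp (conv Δ f g) := by
  have key : pair (j.comp f) (j.comp g) = j.comp (pair f g) :=
    Algebra.TensorProduct.ext' fun x y => by simp
  rw [conv, key, conv, AlgHom.comp_assoc]

theorem triple_comp (j : B →ₐ[K] C) (f g h : A →ₐ[K] B) [CommHom f g] [CommHom f h]
    [CommHom g h] (P : A ⊗[K] (A ⊗[K] A)) :
    triple (j.comp f) (j.comp g) (j.comp h) P = j (triple f g h P) := by
  induction P using induction₃ with
  | zero => simp
  | tmul x y z => simp
  | add s t hs ht => simp only [map_add, hs, ht]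

theorem QuasiBialgebra.unitHom_comp (Q : QuasiBialgebra K A) (j : B →ₐ[K] C) :
    j.comp (Q.unitHom B) = Q.unitHom C := by
  ext a
  simp [Q.unitHom_apply]

/-- A homomorphism placed on the left strand. -/
abbrev strandL (f : A →ₐ[K] B) : A →ₐ[K] B ⊗[K] B := Algebra.TensorProduct.includeLeft.comp f

/-- A homomorphism placed on the right strand. -/
abbrev strandR (f : A →ₐ[K] B) : A →ₐ[K] B ⊗[K] B := Algebra.TensorProduct.includeRight.comp f

variable {E₁ E₂ : B →ₗ[K] A} {f g : A →ₐ[K] B} [CommHom f g]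

theorem LeftEq.strandL (Q : QuasiBialgebra K A) (h : LeftEq E₁ (conv Q.Δ f g) (Q.unitHom B)) :
    LeftEq (TensorProduct.map E₁ E₂) (conv Q.Δ (strandL f) (strandL g)) (Q.unitHom _) := by
  rw [conv_comp, ← Q.unitHom_comp Algebra.TensorProduct.includeLeft]
  intro a T
  induction T with
  | zero => simp
  | tmul x y => simp [h a x]
  | add s t hs ht => simp only [map_add, mul_add, hs, ht]

theorem LeftEq.strandR (Q : QuasiBialgebra K A) (h : LeftEq E₂ (conv Q.Δ f g) (Q.unitHom B)) :
    LeftEq (TensorProduct.map E₁ E₂) (conv Q.Δ (strandR f) (strandR g)) (Q.unitHom _) := by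
  rw [conv_comp, ← Q.unitHom_comp Algebra.TensorProduct.includeRight]
  intro a T
  induction T with
  | zero => simp
  | tmul x y => simp [h a y]
  | add s t hs ht => simp only [map_add, mul_add, hs, ht]

theorem RightEq.strandL (Q : QuasiBialgebra K A) (h : RightEq E₁ (conv Q.Δ f g) (Q.unitHom B)) :
    RightEq (TensorProduct.map E₁ E₂) (conv Q.Δ (strandL f) (strandL g)) (Q.unitHom _) := by
  rw [conv_comp, ← Q.unitHom_comp Algebra.TensorProduct.includeLeft]
  intro a T
  induction T with
  | zero => simp
  | tmul x y => simp [h a x]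
  | add s t hs ht => simp only [map_add, add_mul, hs, ht]

theorem RightEq.strandR (Q : QuasiBialgebra K A) (h : RightEq E₂ (conv Q.Δ f g) (Q.unitHom B)) :
    RightEq (TensorProduct.map E₁ E₂) (conv Q.Δ (strandR f) (strandR g)) (Q.unitHom _) := by
  rw [conv_comp, ← Q.unitHom_comp Algebra.TensorProduct.includeRight]
  intro a T
  induction T with
  | zero => simp
  | tmul x y => simp [h a y]
  | add s t hs ht => simp only [map_add, add_mul, hs, ht]

end Strands

namespace QuasiHopfAlgebra

variable (H : QuasiHopfAlgebra K A)

/-- `x ⊗ y ⊗ z ↦ x β S(y) α z`. -/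
abbrev zigzag : A ⊗[K] (A ⊗[K] A) →ₗ[K] A :=
  word₃ (AlgHom.id K A).toLinearMap H.S.toLinearMap (AlgHom.id K A).toLinearMap H.β H.α

/-- `x ⊗ y ⊗ z ↦ S(x) α y β S(z)`. -/
abbrev zagzig : A ⊗[K] (A ⊗[K] A) →ₗ[K] A :=
  word₃ H.S.toLinearMap (AlgHom.id K A).toLinearMap H.S.toLinearMap H.α H.β

theorem leftEq_zigzag : LeftEq H.zigzag (conv H.Δ (tri₂ K A) (tri₃ K A)) (H.unitHom _) :=
  leftEq_word₃₂₃ H.S_mul (fun _ _ => rfl) _ H.antipodeData.ev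

theorem rightEq_zigzag : RightEq H.zigzag (conv H.Δ (tri₁ K A) (tri₂ K A)) (H.unitHom _) :=
  rightEq_word₃₁₂ (fun _ _ => rfl) H.S_mul _ H.antipodeData.coev

theorem leftEq_zagzig : LeftEq H.zagzig (conv H.Δ (tri₁ K A) (tri₂ K A)) (H.unitHom _) :=
  leftEq_word₃₁₂ H.S_mul (fun _ _ => rfl) _ H.antipodeData.ev

theorem rightEq_zagzig : RightEq H.zagzig (conv H.Δ (tri₂ K A) (tri₃ K A)) (H.unitHom _) :=
  rightEq_word₃₂₃ (fun _ _ => rfl) H.S_mul _ H.antipodeData.coev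

/-- Separates the tensor factors of `A ⊗ A`: each strand carries one word `x β S(y) α z`, and the
nesting of dual pairs shows only in the order in which the six legs are fed to `D` and `G`. -/
theorem deltaMap_gammaMap_eq (C₁ C₂ C₃ : A ⊗[K] A) (D G : (A ⊗[K] A) ⊗[K] (A ⊗[K] A)) :
    C₁ * H.deltaMap D * H.SS (swap K A C₂) * gammaMap H.S H.α G * C₃ =
      TensorProduct.map H.zigzag H.zigzag
        (quadruple (strandR (tri₂ K A)) (strandL (tri₂ K A)) (strandL (tri₃ K A))
            (strandR (tri₃ K A)) G *
          (pair (strandL (tri₁ K A)) (strandR (tri₁ K A)) C₁ *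
            (pair (strandR (tri₂ K A)) (strandL (tri₂ K A)) C₂ *
              pair (strandL (tri₃ K A)) (strandR (tri₃ K A)) C₃)) *
          quadruple (strandL (tri₁ K A)) (strandR (tri₁ K A)) (strandR (tri₂ K A))
            (strandL (tri₂ K A)) D) := by
  induction C₁ with
  | zero => simp
  | add s t hs ht => simp only [map_add, add_mul, mul_add, hs, ht]
  | tmul x₁ y₁ =>
    induction C₂ with
    | zero => simp
    | add s t hs ht => simp only [map_add, add_mul, mul_add, hs, ht]
    | tmul x₂ y₂ =>
      induction C₃ with
      | zero => simp
      | add s t hs ht => simp only [map_add, add_mul, mul_add, hs, ht]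
      | tmul x₃ y₃ =>
        induction D using induction₄ with
        | zero => simp
        | add s t hs ht => simp only [map_add, add_mul, mul_add, hs, ht]
        | tmul a b c d =>
          induction G using induction₄ with
          | zero => simp
          | add s t hs ht => simp only [map_add, add_mul, mul_add, hs, ht]
          | tmul a b c d =>
            simp [SS_tmul, swap_tmul, deltaMap_tmul, gammaMap_tmul, word₃_tmul, H.S_mul, mul_assoc]

theorem gammaMap_deltaMap_eq (C₁ C₂ C₃ : A ⊗[K] A) (D G : (A ⊗[K] A) ⊗[K] (A ⊗[K] A)) :
    H.SS (swap K A C₁) * gammaMap H.S H.α G * C₂ * H.deltaMap D * H.SS (swap K A C₃) =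
      TensorProduct.map H.zagzig H.zagzig
        (quadruple (strandR (tri₁ K A)) (strandL (tri₁ K A)) (strandL (tri₂ K A))
            (strandR (tri₂ K A)) G *
          (pair (strandR (tri₁ K A)) (strandL (tri₁ K A)) C₁ *
            (pair (strandL (tri₂ K A)) (strandR (tri₂ K A)) C₂ *
              pair (strandR (tri₃ K A)) (strandL (tri₃ K A)) C₃)) *
          quadruple (strandL (tri₂ K A)) (strandR (tri₂ K A)) (strandR (tri₃ K A))
            (strandL (tri₃ K A)) D) := by
  induction C₁ with
  | zero => simp
  | add s t hs ht => simp only [map_add, add_mul, mul_add, hs, ht]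
  | tmul x₁ y₁ =>
    induction C₂ with
    | zero => simp
    | add s t hs ht => simp only [map_add, add_mul, mul_add, hs, ht]
    | tmul x₂ y₂ =>
      induction C₃ with
      | zero => simp
      | add s t hs ht => simp only [map_add, add_mul, mul_add, hs, ht]
      | tmul x₃ y₃ =>
        induction D using induction₄ with
        | zero => simp
        | add s t hs ht => simp only [map_add, add_mul, mul_add, hs, ht]
        | tmul a b c d =>
          induction G using induction₄ with
          | zero => simp
          | add s t hs ht => simp only [map_add, add_mul, mul_add, hs, ht]
          | tmul a b c d =>
            simp [SS_tmul, swap_tmul, deltaMap_tmul, gammaMap_tmul, word₃_tmul, H.S_mul, mul_assoc]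

/-- By `eval_zigzag` the whole composite reduces to one copy of `Φ` on each strand, and the snake
identity of `A` holds on each. -/
theorem prod_snake₁ : word₃ H.Δ.toLinearMap H.prodS H.Δ.toLinearMap H.δ H.γ
    (H.Φ : A ⊗[K] (A ⊗[K] A)) = 1 := by
  set a := strandL (tri₁ K A)
  set b := strandR (tri₁ K A)
  set c := strandR (tri₂ K A)
  set d := strandL (tri₂ K A)
  set e := strandL (tri₃ K A)
  set f := strandR (tri₃ K A)
  set E := TensorProduct.map H.zigzag H.zigzag with hE
  have key (P : A ⊗[K] (A ⊗[K] A)) : word₃ H.Δ.toLinearMap H.prodS H.Δ.toLinearMap H.δ H.γ P =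
      E (quadruple c d e f H.gammaWord *
        triple (conv H.Δ a b) (conv H.Δ c d) (conv H.Δ e f) P * quadruple a b c d H.deltaWord) := by
    induction P using induction₃ with
    | zero => simp
    | add s t hs ht => simp only [map_add, mul_add, add_mul, hs, ht]
    | tmul x y z =>
      rw [word₃_tmul, triple_tmul]
      exact H.deltaMap_gammaMap_eq _ _ _ _ _
  have hde : LeftEq E (conv H.Δ d e) (H.unitHom _) := H.leftEq_zigzag.strandL _
  have hcf : LeftEq E (conv H.Δ c f) (H.unitHom _) := H.leftEq_zigzag.strandR _
  have hbc : RightEq E (conv H.Δ b c) (H.unitHom _) := H.rightEq_zigzag.strandR _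
  have had : RightEq E (conv H.Δ a d) (H.unitHom _) := H.rightEq_zigzag.strandL _
  have hz := H.eval_zigzag a b c d e f hde hcf hbc had
  rw [key, quadruple_gammaWord, quadruple_deltaWord, ← H.val_phi, ← Units.val_mul,
    ← Units.val_mul, H.phi_inv_mul_phi, mul_assoc, mul_assoc, H.leftEq_phi₂ hde,
    H.phi_unitHom_mid, one_mul, ← mul_assoc, hz, Units.val_mul, H.val_phi, H.val_phi]
  have h1 : triple b c f (H.Φ : A ⊗[K] (A ⊗[K] A)) = 1 ⊗ₜ (H.Φ : A ⊗[K] (A ⊗[K] A)) :=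
    (triple_comp _ _ _ _ _).trans (by simp [triple_tri])
  have h2 : triple a d e (H.Φ : A ⊗[K] (A ⊗[K] A)) = (H.Φ : A ⊗[K] (A ⊗[K] A)) ⊗ₜ 1 :=
    (triple_comp _ _ _ _ _).trans (by simp [triple_tri])
  have h3 := H.antipodeData.snake₁
  change H.zigzag (H.Φ : A ⊗[K] (A ⊗[K] A)) = 1 at h3
  rw [h1, h2, Algebra.TensorProduct.tmul_mul_tmul, one_mul, mul_one, hE, TensorProduct.map_tmul,
    h3, Algebra.TensorProduct.one_def]

theorem prod_snake₂ : word₃ H.prodS H.Δ.toLinearMap H.prodS H.γ H.δ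
    ((H.Φ⁻¹ : (A ⊗[K] (A ⊗[K] A))ˣ) : A ⊗[K] (A ⊗[K] A)) = 1 := by
  set a := strandR (tri₁ K A)
  set b := strandL (tri₁ K A)
  set c := strandL (tri₂ K A)
  set d := strandR (tri₂ K A)
  set e := strandR (tri₃ K A)
  set f := strandL (tri₃ K A)
  set E := TensorProduct.map H.zagzig H.zagzig with hE
  have key (P : A ⊗[K] (A ⊗[K] A)) : word₃ H.prodS H.Δ.toLinearMap H.prodS H.γ H.δ P =
      E (quadruple a b c d H.gammaWord *
        triple (conv H.Δ a b) (conv H.Δ c d) (conv H.Δ e f) P * quadruple c d e f H.deltaWord) := by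
    induction P using induction₃ with
    | zero => simp
    | add s t hs ht => simp only [map_add, mul_add, add_mul, hs, ht]
    | tmul x y z =>
      rw [word₃_tmul, triple_tmul]
      exact H.gammaMap_deltaMap_eq _ _ _ _ _
  have hbc : LeftEq E (conv H.Δ b c) (H.unitHom _) := H.leftEq_zagzig.strandL _
  have had : LeftEq E (conv H.Δ a d) (H.unitHom _) := H.leftEq_zagzig.strandR _
  have hde : RightEq E (conv H.Δ d e) (H.unitHom _) := H.rightEq_zagzig.strandR _
  have hcf : RightEq E (conv H.Δ c f) (H.unitHom _) := H.rightEq_zagzig.strandL _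
  set Q := H.toQuasiBialgebra with hQ
  -- Passing to the coopposite reverses the legs and inverts the associators, which turns this snake
  -- identity into the preceding one.
  have hz := Q.cop.eval_zigzag f e d c b a (E := E)
    (by rw [Q.conv_cop rfl rfl]; exact hbc) (by rw [Q.conv_cop rfl rfl]; exact had)
    (by rw [Q.conv_cop rfl rfl]; exact hde) (by rw [Q.conv_cop rfl rfl]; exact hcf)
  rw [Q.phi_cop (Q.conv_cop rfl rfl) (Q.conv_cop rfl rfl) (Q.conv_cop rfl rfl),
    Q.phi_cop (Q.conv_cop rfl rfl) rfl rfl, Q.phi_cop (Q.conv_cop rfl rfl) rfl rfl,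
    Q.phi_cop rfl rfl rfl, Q.phi_cop rfl rfl rfl, Q.phi_cop rfl rfl rfl,
    Q.phi_cop rfl rfl rfl, inv_inv, inv_inv] at hz
  -- The pentagon rewrites the word of `δ` so that its last associator has the created pair `de` as
  -- a leg and disappears.
  have hδ : Q.phi (conv Q.Δ c d) e f * (Q.phi c d e)⁻¹ =
      (Q.phi c d (conv Q.Δ e f))⁻¹ * Q.phi d e f * Q.phi c (conv Q.Δ d e) f := by
    rw [mul_inv_eq_iff_eq_mul, mul_assoc, mul_assoc, eq_inv_mul_iff_mul_eq, Q.phi_pentagon,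
      mul_assoc]
  rw [key, quadruple_gammaWord, quadruple_deltaWord, ← Q.val_phi_inv, ← Units.val_mul,
    ← Units.val_mul, hδ, ← mul_assoc, ← mul_assoc, Q.rightEq_phi₂ hde, Q.phi_unitHom_mid, mul_one,
    mul_assoc, hz, Units.val_mul, Q.val_phi_inv, Q.val_phi_inv]
  set P := ((Q.Φ⁻¹ : (A ⊗[K] (A ⊗[K] A))ˣ) : A ⊗[K] (A ⊗[K] A))
  have h1 : triple b c f P = P ⊗ₜ 1 := (triple_comp _ _ _ _ _).trans (by simp [triple_tri])
  have h2 : triple a d e P = 1 ⊗ₜ P := (triple_comp _ _ _ _ _).trans (by simp [triple_tri])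
  have h3 : H.zagzig P = 1 := H.antipodeData.snake₂
  rw [h1, h2, Algebra.TensorProduct.tmul_mul_tmul, one_mul, mul_one, hE, TensorProduct.map_tmul,
    h3, Algebra.TensorProduct.one_def]

/-- The antipode data `((S ⊗ S)Δᵒᵖ, γ, δ)` over the coproduct. -/
def prodData : AntipodeData H.toQuasiBialgebra H.Δ where
  S := H.prodS
  S_one := by simp [prodS_apply, H.SS_one]
  S_mul x y := by simp [prodS_apply, H.SS_mul]
  α := H.γ
  β := H.δ
  ev := H.prodS_ev
  coev := H.prodS_coev
  snake₁ := H.prod_snake₁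
  snake₂ := H.prod_snake₂

/-- The antipode data `(ΔS, Δ(α), Δ(β))` over the coproduct. -/
def comulData : AntipodeData H.toQuasiBialgebra H.Δ := H.antipodeData.map H.Δ

/-- The defining formula of `F` is the comparison word itself. Invertibility, the relation with
`prodS` and `F Δ(α) = γ` follow from the general theory. -/
theorem compare_prodData_comulData : AntipodeData.compare H.prodData H.comulData = H.F := by
  have key : word₃ H.prodS H.Δ.toLinearMap H.comulData.S H.γ H.comulData.β = H.FMap := by
    ext x y z
    simp [word₃_tmul, FMap_tmul, prodS_apply, comulData, AntipodeData.map, antipodeData, mul_assoc]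
  exact congrArg (fun φ => φ H.Φinv) key

/-- The Drinfel'd twist as a unit. -/
def twist : (A ⊗[K] A)ˣ := AntipodeData.compareUnit H.prodData H.comulData

theorem val_twist : (H.twist : A ⊗[K] A) = H.F := H.compare_prodData_comulData

theorem prodS_mul_twist (x : A) : H.prodS x * H.twist = H.twist * H.Δ (H.S x) :=
  AntipodeData.S_mul_compare H.prodData H.comulData x

theorem twist_mul_Δ_α : (H.twist : A ⊗[K] A) * H.Δ H.α = H.γ :=
  AntipodeData.compare_mul_α H.prodData H.comulData

end QuasiHopfAlgebra

end

/-! ### The braiding on legs: hexagons, units and naturality. -/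

section

variable {K : Type u} {A : Type v} [Field K] [Ring A] [Algebra K A]

namespace QuasitriangularQuasiHopfAlgebra

variable (H : QuasitriangularQuasiHopfAlgebra K A)
variable {L : Type w} [Ring L] [Algebra K L]

/-- The image of the R-matrix under `x ⊗ y ↦ f x * g y`. -/
def braid (f g : A →ₐ[K] L) [CommHom f g] : Lˣ :=
  Units.map (pair f g : A ⊗[K] A →* L) H.R

section

variable (f g h : A →ₐ[K] L) [CommHom f g]

theorem val_braid : (H.braid f g : L) = pair f g (H.R : A ⊗[K] A) := rfl

theorem val_braid_inv : ((H.braid f g)⁻¹ : Lˣ) =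
    pair f g ((H.R⁻¹ : (A ⊗[K] A)ˣ) : A ⊗[K] A) := rfl

theorem braid_conv (a : A) : H.braid f g * conv H.Δ f g a = conv H.Δ g f a * H.braid f g := by
  rw [conv_apply, conv_apply, val_braid, ← map_mul, ← H.quasi_cocomm, map_mul, pair_swap]

theorem commute_braid [CommHom h f] [CommHom h g] (a : A) :
    Commute (H.braid f g : L) (h a) :=
  (commute_pair (CommHom.comm a) (CommHom.comm a) _).symm

variable [CommHom f h] [CommHom g h]

theorem triple_permYZX (P : A ⊗[K] (A ⊗[K] A)) :
    triple f g h (permYZX K A P) = triple h f g P := by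
  induction P using induction₃ with
  | zero => simp
  | tmul x y z =>
    rw [permYZX_tmul, triple_tmul, triple_tmul, (CommHom.comm z x : Commute (g z) (h x)).eq,
      commute_swap_left (f := f) (g := h)]
  | add s t hs ht => simp only [map_add, hs, ht]

theorem triple_permZXY (P : A ⊗[K] (A ⊗[K] A)) :
    triple f g h (permZXY K A P) = triple g h f P := by
  induction P using induction₃ with
  | zero => simp
  | tmul x y z =>
    rw [permZXY_tmul, triple_tmul, triple_tmul, commute_swap_left (f := f) (g := g),
      (CommHom.comm z y : Commute (f z) (h y)).eq]
  | add s t hs ht => simp only [map_add, hs, ht]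

theorem triple_permYXZ (P : A ⊗[K] (A ⊗[K] A)) :
    triple f g h (permYXZ K A P) = triple g f h P := by
  induction P using induction₃ with
  | zero => simp
  | tmul x y z =>
    rw [permYXZ_tmul, triple_tmul, triple_tmul, commute_swap_left (f := f) (g := g)]
  | add s t hs ht => simp only [map_add, hs, ht]

theorem triple_perm132 (P : A ⊗[K] (A ⊗[K] A)) :
    triple f g h (perm132 K A P) = triple f h g P := by
  induction P using induction₃ with
  | zero => simp
  | tmul x y z =>
    rw [perm132_tmul, triple_tmul, triple_tmul, (CommHom.comm z y : Commute (g z) (h y)).eq]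
  | add s t hs ht => simp only [map_add, hs, ht]

theorem triple_leg12 (D : A ⊗[K] A) : triple f g h (leg12 K A D) = pair f g D := by
  induction D with
  | zero => simp
  | tmul x y => simp [leg12_tmul]
  | add s t hs ht => simp only [map_add, hs, ht]

theorem triple_leg13 (D : A ⊗[K] A) : triple f g h (leg13 K A D) = pair f h D := by
  induction D with
  | zero => simp
  | tmul x y => simp [leg13_tmul]
  | add s t hs ht => simp only [map_add, hs, ht]

theorem triple_leg23 (D : A ⊗[K] A) : triple f g h (leg23 K A D) = pair g h D := by
  induction D with
  | zero => simp
  | tmul x y => simp [leg23_tmul]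
  | add s t hs ht => simp only [map_add, hs, ht]

theorem braid_left : H.braid (conv H.Δ f g) h =
    H.phi h f g * H.braid f h * (H.phi f h g)⁻¹ * H.braid g h * H.phi f g h := by
  ext
  simp only [Units.val_mul, val_braid, H.val_phi, H.val_phi_inv]
  rw [pair_conv_left, H.hexagon_left]
  simp only [map_mul, triple_permYZX, triple_perm132, triple_leg13, triple_leg23]

theorem braid_right : H.braid f (conv H.Δ g h) =
    (H.phi g h f)⁻¹ * H.braid f h * H.phi g f h * H.braid f g * (H.phi f g h)⁻¹ := by
  ext
  simp only [Units.val_mul, val_braid, H.val_phi, H.val_phi_inv]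
  rw [pair_conv_right, H.hexagon_right]
  simp only [map_mul, triple_permZXY, triple_permYXZ, triple_leg13, triple_leg12]

end

@[simp]
-- A hexagon with two units makes this braiding idempotent, hence `1`.
theorem braid_unitHom_left (f : A →ₐ[K] L) : H.braid (H.unitHom L) f = 1 := by
  have h := H.braid_left (H.unitHom L) (H.unitHom L) f
  simp only [H.conv_unitHom_left, H.phi_unitHom_mid, H.phi_unitHom_left, inv_one, one_mul,
    mul_one] at h
  exact mul_eq_left.mp h.symm

@[simp]
theorem braid_unitHom_right (f : A →ₐ[K] L) : H.braid f (H.unitHom L) = 1 := by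
  have h := H.braid_right f (H.unitHom L) (H.unitHom L)
  simp only [H.conv_unitHom_left, H.phi_unitHom_mid, H.phi_unitHom_left, inv_one, one_mul,
    mul_one] at h
  exact mul_eq_left.mp h.symm

section Kill

variable {M : Type w'} [AddCommGroup M] [Module K M] {E : L →ₗ[K] M} {m m' f : A →ₐ[K] L}

theorem leftEq_braid₂ [CommHom f m] [CommHom f m'] (h : LeftEq E m m') (T : Lˣ) :
    E ↑(H.braid f m * T) = E ↑(H.braid f m' * T) :=
  h.pair₂ _ _

theorem leftEq_braid_inv₁ [CommHom m f] [CommHom m' f] (h : LeftEq E m m') (T : Lˣ) :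
    E ↑((H.braid m f)⁻¹ * T) = E ↑((H.braid m' f)⁻¹ * T) :=
  h.pair₁ _ _

theorem leftEq_braid_inv₂ [CommHom f m] [CommHom f m'] (h : LeftEq E m m') (T : Lˣ) :
    E ↑((H.braid f m)⁻¹ * T) = E ↑((H.braid f m')⁻¹ * T) :=
  h.pair₂ _ _

theorem rightEq_braid₁ [CommHom m f] [CommHom m' f] (h : RightEq E m m') (T : Lˣ) :
    E ↑(T * H.braid m f) = E ↑(T * H.braid m' f) :=
  h.pair₁ _ _

theorem rightEq_braid₂ [CommHom f m] [CommHom f m'] (h : RightEq E m m') (T : Lˣ) :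
    E ↑(T * H.braid f m) = E ↑(T * H.braid f m') :=
  h.pair₂ _ _

end Kill

section

variable {m m' f : A →ₐ[K] L} {X : Lˣ}

theorem mul_braid₁ [CommHom m f] [CommHom m' f] (hm : ∀ a, X * m a = m' a * X)
    (hf : ∀ a, Commute (X : L) (f a)) : X * H.braid m f = H.braid m' f * X :=
  Units.ext (mul_pair₁ hm hf _)

theorem mul_braid₂ [CommHom f m] [CommHom f m'] (hm : ∀ a, X * m a = m' a * X)
    (hf : ∀ a, Commute (X : L) (f a)) : X * H.braid f m = H.braid f m' * X :=
  Units.ext (mul_pair₂ hm hf _)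

end

/-- Used for the snake identities of `braidData`: the braidings on the right involve `bc` and `ab`
as whole legs, so they vanish when these are dual pairs, leaving only the associator. The proof
combines both hexagons with naturality of the braiding with `a` along the braiding of `c` and `b`.
-/
theorem braid_flip (a b c : A →ₐ[K] L) [CommHom a b] [CommHom a c] [CommHom b c] :
    H.braid c b * (H.phi c b a)⁻¹ * (H.braid b a)⁻¹ =
      (H.braid (conv H.Δ b c) a)⁻¹ * H.phi a b c * H.braid c (conv H.Δ a b) := by
  have h := H.mul_braid₁ (f := a) (H.braid_conv c b) (fun x => H.commute_braid c b a x)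
  rw [← mul_inv_eq_iff_eq_mul] at h
  rw [← h, H.braid_left, H.braid_right]
  group

/-- The braid identity behind the coproduct formula. Hexagons and pentagons are arranged so that a
dual pair passes strands or associators as a whole; such factors are trivial under `E`, and what
remains is two crossings and the `γ` word for `c, d, a, b`. -/
theorem eval_braid (a b c d : A →ₐ[K] L) [CommHom a b] [CommHom a c] [CommHom a d] [CommHom b c]
    [CommHom b d] [CommHom c d] {M : Type w'} [AddCommGroup M] [Module K M] {E : L →ₗ[K] M}
    (hbc : LeftEq E (conv H.Δ b c) (H.unitHom _)) (had : LeftEq E (conv H.Δ a d) (H.unitHom _)) :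
    E ↑((H.phi b c d)⁻¹ * H.phi a b (conv H.Δ c d) *
      H.braid (conv H.Δ c d) (conv H.Δ a b) * (H.braid d c * H.braid c d)) =
    E ↑(H.braid c b * H.braid d a * ((H.phi d a b)⁻¹ * H.phi c d (conv H.Δ a b))) := by
  -- The crossing of `c` and `b` stays in front throughout; behind it, the pair being evaluated
  -- reads `cb` instead of `bc`.
  have kbc : LeftEq (E ∘ₗ LinearMap.mulLeft K (H.braid c b : L)) (conv H.Δ c b) (H.unitHom _) :=
    hbc.intertwine (H.braid_conv c b) (fun x => H.commute_braid c b _ x)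
  have kad : LeftEq (E ∘ₗ LinearMap.mulLeft K (H.braid c b : L)) (conv H.Δ a d) (H.unitHom _) :=
    had.mulLeft (fun x => H.commute_braid c b _ x) (fun x => H.commute_braid c b _ x)
  -- both hexagons
  have h1 : (H.phi b c d)⁻¹ * H.phi a b (conv H.Δ c d) *
      H.braid (conv H.Δ c d) (conv H.Δ a b) * (H.braid d c * H.braid c d) =
      H.braid c b * (H.braid d (conv H.Δ c b) * (H.phi d c b * ((H.braid d c)⁻¹ *
        (H.phi a (conv H.Δ c d) b * H.braid (conv H.Δ c d) a * (H.phi (conv H.Δ c d) a b)⁻¹) *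
          H.braid d c) * H.braid c d)) := by
    rw [H.braid_right (conv H.Δ c d) a b, H.braid_left c d b, H.braid_right d c b]
    group
  -- naturality of the braiding
  have h2 : (H.braid d c)⁻¹ *
      (H.phi a (conv H.Δ c d) b * H.braid (conv H.Δ c d) a * (H.phi (conv H.Δ c d) a b)⁻¹) *
        H.braid d c =
      H.phi a (conv H.Δ d c) b * H.braid (conv H.Δ d c) a * (H.phi (conv H.Δ d c) a b)⁻¹ := by
    have e1 := H.mul_phi₂ (f := a) (g := b) (H.braid_conv d c)
      (fun x => H.commute_braid d c a x) (fun x => H.commute_braid d c b x)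
    have e2 := H.mul_braid₁ (f := a) (H.braid_conv d c) (fun x => H.commute_braid d c a x)
    have e3 := H.mul_phi₁ (f := a) (g := b) (H.braid_conv d c)
      (fun x => H.commute_braid d c a x) (fun x => H.commute_braid d c b x)
    rw [← mul_inv_eq_iff_eq_mul] at e1 e2 e3
    rw [← e1, ← e2, ← e3]
    group
  have h3 : H.phi d c b *
      (H.phi a (conv H.Δ d c) b * H.braid (conv H.Δ d c) a * (H.phi (conv H.Δ d c) a b)⁻¹) *
        H.braid c d =
      H.phi a d (conv H.Δ c b) * (H.phi (conv H.Δ a d) c b * (H.braid c (conv H.Δ a d) *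
        (H.braid d a * (H.phi c d a * (H.phi (conv H.Δ c d) a b)⁻¹)))) := by
    have e1 := H.mul_phi₁ (f := a) (g := b) (H.braid_conv c d)
      (fun x => H.commute_braid c d a x) (fun x => H.commute_braid c d b x)
    have e2 := H.mul_braid₂ (f := c) (H.braid_conv d a) (fun x => H.commute_braid d a c x)
    have e3 := H.phi_pentagon a d c b
    rw [← mul_inv_eq_iff_eq_mul] at e1 e2
    rw [← eq_mul_inv_iff_mul_eq] at e3
    rw [← e1, ← e2, e3, H.braid_left, H.braid_right]
    group
  have h4 : H.braid c b * H.braid d a * ((H.phi d a b)⁻¹ * H.phi c d (conv H.Δ a b)) =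
      H.braid c b * (H.phi c (conv H.Δ a d) b *
        (H.braid d a * (H.phi c d a * (H.phi (conv H.Δ c d) a b)⁻¹))) := by
    have e1 := H.mul_phi₂ (f := c) (g := b) (H.braid_conv d a)
      (fun x => H.commute_braid d a c x) (fun x => H.commute_braid d a b x)
    rw [H.phi_inv_mul_phi, ← mul_assoc (H.phi c (conv H.Δ a d) b), ← e1]
    group
  have k1 := H.leftEq_braid₂ (f := d) kbc
  have k2 := H.leftEq_phi₃ (f := a) (g := d) kbc
  have k3 := H.leftEq_phi₁ (f := c) (g := b) kad
  have k4 := H.leftEq_braid₂ (f := c) kad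
  have k5 := H.leftEq_phi₂ (f := c) (g := b) kad
  simp only [LinearMap.comp_apply, LinearMap.mulLeft_apply, ← Units.val_mul, H.phi_unitHom_left,
    H.phi_unitHom_mid, H.phi_unitHom_right, braid_unitHom_right, one_mul] at k1 k2 k3 k4 k5
  rw [h1, k1, h2, h3, k2, k3, k4, h4, k5]

end QuasitriangularQuasiHopfAlgebra

end

/-! ### Antipodes of the coopposite quasi-bialgebra; the Drinfel'd element and its coproduct. -/

section

variable {K : Type u} {A : Type v} [Field K] [Ring A] [Algebra K A]

namespace QuasiHopfAlgebra

variable (H : QuasiHopfAlgebra K A)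

theorem S_symm_one : H.S.symm 1 = 1 := by
  rw [LinearEquiv.symm_apply_eq, H.S_one]

theorem S_symm_mul (x y : A) : H.S.symm (x * y) = H.S.symm y * H.S.symm x := by
  rw [LinearEquiv.symm_apply_eq, H.S_mul, LinearEquiv.apply_symm_apply,
    LinearEquiv.apply_symm_apply]

theorem cop_Δ_apply (x : A) : H.cop.Δ x = swap K A (H.Δ x) := rfl

theorem val_cop_Φ : (H.cop.Φ : A ⊗[K] (A ⊗[K] A)) = reverse K A H.Φinv := rfl

theorem val_cop_Φ_inv : ((H.cop.Φ⁻¹ : (A ⊗[K] (A ⊗[K] A))ˣ) : A ⊗[K] (A ⊗[K] A)) =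
    reverse K A (H.Φ : A ⊗[K] (A ⊗[K] A)) := rfl

/-- The antipode data `(S⁻¹, S⁻¹(α), S⁻¹(β))` of the coopposite quasi-bialgebra. -/
def copData : AntipodeData H.cop (AlgHom.id K A) where
  S := H.S.symm.toLinearMap
  S_one := H.S_symm_one
  S_mul := H.S_symm_mul
  α := H.S.symm H.α
  β := H.S.symm H.β
  ev x := by
    have key (D : A ⊗[K] A) : word₂ H.S.symm.toLinearMap (AlgHom.id K A).toLinearMap
        (H.S.symm H.α) (swap K A D) = H.S.symm (evMap H.S H.α D) := by
      induction D with
      | zero => simp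
      | tmul x y => simp [swap_tmul, word₂_tmul, evMap_tmul, S_symm_mul, mul_assoc]
      | add s t hs ht => simp only [map_add, hs, ht]
    rw [cop_Δ_apply, key, H.antipode_left, map_smul]
    rfl
  coev x := by
    have key (D : A ⊗[K] A) : word₂ (AlgHom.id K A).toLinearMap H.S.symm.toLinearMap
        (H.S.symm H.β) (swap K A D) = H.S.symm (coevMap H.S H.β D) := by
      induction D with
      | zero => simp
      | tmul x y => simp [swap_tmul, word₂_tmul, coevMap_tmul, S_symm_mul, mul_assoc]
      | add s t hs ht => simp only [map_add, hs, ht]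
    rw [cop_Δ_apply, key, H.antipode_right, map_smul]
    rfl
  snake₁ := by
    have key (P : A ⊗[K] (A ⊗[K] A)) : word₃ (AlgHom.id K A).toLinearMap H.S.symm.toLinearMap
        (AlgHom.id K A).toLinearMap (H.S.symm H.β) (H.S.symm H.α) (reverse K A P) =
          H.S.symm (dualMap₂ H.S H.α H.β P) := by
      induction P using induction₃ with
      | zero => simp
      | tmul x y z => simp [reverse_tmul, word₃_tmul, dualMap₂_tmul, S_symm_mul, mul_assoc]
      | add s t hs ht => simp only [map_add, hs, ht]
    rw [val_cop_Φ, key, Φinv, H.duality₂, S_symm_one]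
  snake₂ := by
    have key (P : A ⊗[K] (A ⊗[K] A)) : word₃ H.S.symm.toLinearMap (AlgHom.id K A).toLinearMap
        H.S.symm.toLinearMap (H.S.symm H.α) (H.S.symm H.β) (reverse K A P) =
          H.S.symm (dualMap₁ H.S H.α H.β P) := by
      induction P using induction₃ with
      | zero => simp
      | tmul x y z => simp [reverse_tmul, word₃_tmul, dualMap₁_tmul, S_symm_mul, mul_assoc]
      | add s t hs ht => simp only [map_add, hs, ht]
    rw [val_cop_Φ_inv, key, H.duality₁, S_symm_one]

/-- Apply `ε` to the first duality identity; `ε(α)` factors out of every term. -/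
theorem counit_α_mul : ∃ c : K, H.ε H.α * c = 1 := by
  have key (P : A ⊗[K] (A ⊗[K] A)) : ∃ c : K, H.ε (dualMap₁ H.S H.α H.β P) = H.ε H.α * c := by
    induction P using induction₃ with
    | zero => exact ⟨0, by simp⟩
    | tmul x y z =>
      exact ⟨H.ε x * H.ε H.β * H.ε (H.S y) * H.ε z, by simp only [dualMap₁_tmul, map_mul]; ring⟩
    | add s t hs ht =>
      obtain ⟨c, hc⟩ := hs
      obtain ⟨d, hd⟩ := ht
      exact ⟨c + d, by rw [map_add, map_add, hc, hd, mul_add]⟩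
  obtain ⟨c, hc⟩ := key H.Φ
  exact ⟨c, by rw [← hc, H.duality₁, map_one]⟩

theorem counit_α_ne_zero : H.ε H.α ≠ 0 := by
  obtain ⟨c, hc⟩ := H.counit_α_mul
  exact left_ne_zero_of_mul_eq_one hc

/-- Apply `ε` to `S(x₁) α x₂ = ε(x) α` and cancel the nonzero scalar `ε(α)`. -/
theorem counit_S (x : A) : H.ε (H.S x) = H.ε x := by
  have key (D : A ⊗[K] A) : H.ε (evMap H.S H.α D) = H.ε (H.S (idEps H.ε D)) * H.ε H.α := by
    induction D with
    | zero => simp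
    | tmul y z =>
      simp only [evMap_tmul, idEps_tmul, map_mul, map_smul, smul_eq_mul]
      ring
    | add s t hs ht => simp only [map_add, add_mul, hs, ht]
  have h := key (H.Δ x)
  rw [H.antipode_left, H.counit_right, map_smul, smul_eq_mul] at h
  exact (mul_right_cancel₀ H.counit_α_ne_zero h).symm

end QuasiHopfAlgebra

namespace QuasitriangularQuasiHopfAlgebra

variable (H : QuasitriangularQuasiHopfAlgebra K A)

/-- The inverse of the R-matrix, as an element of `A ⊗ A`. -/
def Rinv : A ⊗[K] A := ((H.R⁻¹ : (A ⊗[K] A)ˣ) : A ⊗[K] A)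

/-- `∑ S(t) α s`, where `R = ∑ s ⊗ t`. -/
def braidα : A := evMap H.S H.α (swap K A (H.R : A ⊗[K] A))

/-- `∑ t β S(s)`, where `R⁻¹ = ∑ s ⊗ t`. -/
def braidβ : A := coevMap H.S H.β (swap K A H.Rinv)

theorem swap_Δ_mul_R (x : A) : H.Δ x * swap K A (H.R : A ⊗[K] A) =
    swap K A ((H.R : A ⊗[K] A) * H.Δ x) := by
  rw [← H.quasi_cocomm, map_mul]
  congr 1
  exact ((swap K A).symm_apply_apply (H.Δ x)).symm

theorem swap_Rinv_mul (x : A) : swap K A H.Rinv * H.Δ x =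
    swap K A (H.Δ x * H.Rinv) := by
  have h : H.Rinv * swap K A (H.Δ x) = H.Δ x * H.Rinv := by
    rw [Rinv, Units.inv_mul_eq_iff_eq_mul, ← mul_assoc, ← H.quasi_cocomm,
      Units.mul_inv_cancel_right]
  rw [← h, map_mul]
  congr 1
  exact ((swap K A).symm_apply_apply (H.Δ x)).symm

/-- The antipode data of the coopposite quasi-bialgebra given by twisting `(S, α, β)` by the
inverse of `R'`. -/
def braidData : AntipodeData H.cop (AlgHom.id K A) where
  S := H.S.toLinearMap
  S_one := H.S_one
  S_mul := H.S_mul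
  α := H.braidα
  β := H.braidβ
  ev x := by
    -- The factors around `∑ S(t) α s` combine with `R` into `(R Δ(x))' = Δ(x) R'`. Then `Δ(x)` is
    -- adjacent to `α` and is evaluated.
    have key (C D : A ⊗[K] A) : word₂ H.S.toLinearMap (AlgHom.id K A).toLinearMap
        (evMap H.S H.α (swap K A C)) (swap K A D) = evMap H.S H.α (swap K A (C * D)) := by
      induction D with
      | zero => simp
      | tmul x y =>
        induction C with
        | zero => simp [word₂_tmul, swap_tmul]
        | tmul z w => simp [swap_tmul, word₂_tmul, evMap_tmul, H.S_mul, mul_assoc]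
        | add s t hs ht =>
          rw [map_add, map_add, add_mul, map_add, map_add, ← hs, ← ht]
          simp [swap_tmul, word₂_tmul, mul_add, add_mul]
      | add s t hs ht => simp only [map_add, mul_add, hs, ht]
    have key' (C D : A ⊗[K] A) : evMap H.S H.α (D * C) =
        LinearMap.mul' K A (TensorProduct.map (LinearMap.mulRight K (evMap H.S H.α D) ∘ₗ
          H.S.toLinearMap) LinearMap.id C) := by
      induction C with
      | zero => simp
      | tmul x y =>
        induction D with
        | zero => simp
        | tmul z w => simp [evMap_tmul, H.S_mul, mul_assoc]
        | add s t hs ht =>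
          rw [add_mul, map_add, hs, ht]
          simp [mul_add, add_mul]
      | add s t hs ht => simp only [map_add, mul_add, hs, ht]
    rw [H.cop_Δ_apply, braidα, key, ← H.swap_Δ_mul_R, key', H.antipode_left]
    generalize swap K A (H.R : A ⊗[K] A) = C
    change _ = H.ε x • _
    induction C with
    | zero => simp
    | tmul x y => simp [evMap_tmul, mul_assoc]
    | add s t hs ht => simp only [map_add, smul_add, hs, ht]
  coev x := by
    have key (C D : A ⊗[K] A) : word₂ (AlgHom.id K A).toLinearMap H.S.toLinearMap
        (coevMap H.S H.β (swap K A C)) (swap K A D) = coevMap H.S H.β (swap K A (D * C)) := by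
      induction D with
      | zero => simp
      | tmul x y =>
        induction C with
        | zero => simp [word₂_tmul, swap_tmul]
        | tmul z w => simp [swap_tmul, word₂_tmul, coevMap_tmul, H.S_mul, mul_assoc]
        | add s t hs ht =>
          rw [map_add, map_add, mul_add, map_add, map_add, ← hs, ← ht]
          simp [swap_tmul, word₂_tmul, mul_add, add_mul]
      | add s t hs ht => simp only [map_add, add_mul, hs, ht]
    have key' (C D : A ⊗[K] A) : coevMap H.S H.β (C * D) =
        LinearMap.mul' K A (TensorProduct.map (LinearMap.mulRight K (coevMap H.S H.β D))
          H.S.toLinearMap C) := by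
      induction C with
      | zero => simp
      | tmul x y =>
        induction D with
        | zero => simp
        | tmul z w => simp [coevMap_tmul, H.S_mul, mul_assoc]
        | add s t hs ht =>
          rw [mul_add, map_add, hs, ht]
          simp [mul_add, add_mul]
      | add s t hs ht => simp only [map_add, add_mul, hs, ht]
    rw [H.cop_Δ_apply, braidβ, key, ← H.swap_Rinv_mul, key', H.antipode_right]
    generalize swap K A H.Rinv = C
    change _ = H.ε x • _
    induction C with
    | zero => simp
    | tmul x y => simp [coevMap_tmul, mul_assoc]
    | add s t hs ht => simp only [map_add, smul_add, hs, ht]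
  snake₁ := by
    have key (C D : A ⊗[K] A) (P : A ⊗[K] (A ⊗[K] A)) : word₃ (AlgHom.id K A).toLinearMap
        H.S.toLinearMap (AlgHom.id K A).toLinearMap (coevMap H.S H.β D) (evMap H.S H.α C) P =
        H.zigzag (pair (tri₂ K A) (tri₃ K A) C * P * pair (tri₁ K A) (tri₂ K A) D) := by
      induction P using induction₃ with
      | zero => simp
      | add s t hs ht => simp only [map_add, mul_add, add_mul, hs, ht]
      | tmul x y z =>
        rw [word₃_tmul]
        induction C with
        | zero => simp
        | add s t hs ht => simp only [map_add, mul_add, add_mul, hs, ht]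
        | tmul c c' =>
          induction D with
          | zero => simp
          | add s t hs ht => simp only [map_add, mul_add, add_mul, hs, ht]
          | tmul d d' => simp [word₃_tmul, evMap_tmul, coevMap_tmul, H.S_mul, mul_assoc]
    -- After `braid_flip` both braidings have a dual pair as a leg and vanish, leaving the snake
    -- identity for `Φ`.
    have hf := H.braid_flip (tri₁ K A) (tri₂ K A) (tri₃ K A)
    rw [braidα, braidβ, key, pair_swap, pair_swap, H.val_cop_Φ, ← triple_tri (reverse K A _),
      triple_reverse, ← H.val_braid, Rinv, ← H.val_braid_inv, QuasiHopfAlgebra.Φinv,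
      ← H.val_phi_inv, ← Units.val_mul, ← Units.val_mul, hf, H.rightEq_braid₂ H.rightEq_zigzag,
      H.braid_unitHom_right, mul_one, H.leftEq_braid_inv₁ H.leftEq_zigzag, H.braid_unitHom_left,
      inv_one, one_mul, H.val_phi, triple_tri]
    exact H.antipodeData.snake₁
  snake₂ := by
    have key (C D : A ⊗[K] A) (P : A ⊗[K] (A ⊗[K] A)) : word₃ H.S.toLinearMap
        (AlgHom.id K A).toLinearMap H.S.toLinearMap (evMap H.S H.α C) (coevMap H.S H.β D) P =
        H.zagzig (pair (tri₁ K A) (tri₂ K A) C * P * pair (tri₂ K A) (tri₃ K A) D) := by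
      induction P using induction₃ with
      | zero => simp
      | add s t hs ht => simp only [map_add, mul_add, add_mul, hs, ht]
      | tmul x y z =>
        rw [word₃_tmul]
        induction C with
        | zero => simp
        | add s t hs ht => simp only [map_add, mul_add, add_mul, hs, ht]
        | tmul c c' =>
          induction D with
          | zero => simp
          | add s t hs ht => simp only [map_add, mul_add, add_mul, hs, ht]
          | tmul d d' => simp [word₃_tmul, evMap_tmul, coevMap_tmul, H.S_mul, mul_assoc]
    have hf := congrArg Inv.inv (H.braid_flip (tri₁ K A) (tri₂ K A) (tri₃ K A))
    simp only [mul_inv_rev, inv_inv, ← mul_assoc] at hf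
    rw [braidα, braidβ, key, pair_swap, pair_swap, H.val_cop_Φ_inv, ← triple_tri (reverse K A _),
      triple_reverse, ← H.val_braid, Rinv, ← H.val_braid_inv, ← H.val_phi, ← Units.val_mul,
      ← Units.val_mul, hf, H.rightEq_braid₁ H.rightEq_zagzig, H.braid_unitHom_left, mul_one,
      H.leftEq_braid_inv₂ H.leftEq_zagzig, H.braid_unitHom_right, inv_one, one_mul, H.val_phi_inv,
      triple_tri]
    exact H.antipodeData.snake₂

/-- The Drinfel'd element as a unit. -/
def drinfeldUnit : Aˣ := AntipodeData.compareUnit H.braidData H.copData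

theorem S_mul_drinfeldUnit (x : A) : H.S x * H.drinfeldUnit = H.drinfeldUnit * H.S.symm x :=
  AntipodeData.S_mul_compare H.braidData H.copData x

theorem drinfeldUnit_mul_α : H.drinfeldUnit * H.S.symm H.α = H.braidα :=
  AntipodeData.compare_mul_α H.braidData H.copData

/-- The comparison word is not the defining formula of `u`. Substituting `∑ S(t) α s = v S⁻¹(α)`
into that formula, with `v` the comparison element, and moving `v` to the left turns the rest into
`S⁻¹` of the second duality identity. -/
theorem val_drinfeldUnit : (H.drinfeldUnit : A) = H.drinfeldElement := by
  have key (P : A ⊗[K] (A ⊗[K] A)) :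
      H.drinfeldMap P = H.drinfeldUnit * H.S.symm (dualMap₂ H.S H.α H.β P) := by
    induction P using induction₃ with
    | zero => simp
    | tmul x y z =>
      rw [drinfeldMap_tmul]
      change _ * H.braidα * x = _
      rw [← drinfeldUnit_mul_α, ← mul_assoc, S_mul_drinfeldUnit, dualMap₂_tmul]
      simp [H.S_symm_mul, mul_assoc]
    | add s t hs ht => simp only [map_add, mul_add, hs, ht]
  rw [drinfeldElement, key, QuasiHopfAlgebra.Φinv, H.duality₂, H.S_symm_one, mul_one]

theorem counit_drinfeldUnit : H.ε H.drinfeldUnit = 1 := by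
  have key (D : A ⊗[K] A) : H.ε (evMap H.S H.α (swap K A D)) =
      H.ε H.α * pair (H.unitHom K) (H.unitHom K) D := by
    induction D with
    | zero => simp
    | tmul x y =>
      simp only [swap_tmul, evMap_tmul, map_mul, H.counit_S, pair_tmul, H.unitHom_apply,
        Algebra.algebraMap_self, RingHom.id_apply]
      ring
    | add s t hs ht => simp only [map_add, mul_add, hs, ht]
  have h := congrArg H.ε H.drinfeldUnit_mul_α
  rw [braidα, key, ← H.val_braid, H.braid_unitHom_left, Units.val_one, mul_one, map_mul,
    ← H.counit_S (H.S.symm H.α), LinearEquiv.apply_symm_apply] at h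
  exact mul_right_cancel₀ H.counit_α_ne_zero (h.trans (one_mul _).symm)

theorem S_S (x : A) : H.S (H.S x) * H.drinfeldUnit = H.drinfeldUnit * x := by
  rw [S_mul_drinfeldUnit, LinearEquiv.symm_apply_apply]

theorem SS_SS_mul (D : A ⊗[K] A) :
    H.SS (H.SS D) * ((H.drinfeldUnit : A) ⊗ₜ[K] (H.drinfeldUnit : A)) =
      ((H.drinfeldUnit : A) ⊗ₜ[K] (H.drinfeldUnit : A)) * D := by
  induction D with
  | zero => simp
  | tmul x y => simp [H.SS_tmul, S_S]
  | add s t hs ht => simp only [map_add, add_mul, mul_add, hs, ht]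

theorem Rswap_mul_R_mul_Δ (x : A) : ((H.Rswap * H.R : (A ⊗[K] A)ˣ) : A ⊗[K] A) * H.Δ x =
    H.Δ x * ((H.Rswap * H.R : (A ⊗[K] A)ˣ) : A ⊗[K] A) := by
  have h : swap K A (H.R : A ⊗[K] A) * swap K A (H.Δ x) = H.Δ x * swap K A (H.R : A ⊗[K] A) := by
    rw [H.swap_Δ_mul_R, map_mul]
  rw [Units.val_mul, mul_assoc, ← H.quasi_cocomm, ← mul_assoc, ← mul_assoc]
  congr 1

/-- In each tensor factor `S(S(a) α b) u = S(b) S(α) S²(a) u = S(b) (∑ S(t) α s) a`, since `S(α) u =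
u S⁻¹(α)`. Applying `S` thus interchanges the two letters and puts a crossing between them. -/
theorem SS_swap_gamma_mul (G : (A ⊗[K] A) ⊗[K] (A ⊗[K] A)) :
    H.SS (swap K A (gammaMap H.S H.α G)) * ((H.drinfeldUnit : A) ⊗ₜ[K] (H.drinfeldUnit : A)) =
      gammaMap H.S H.α (H.braid (quad₃ K A) (quad₂ K A) * H.braid (quad₄ K A) (quad₁ K A) *
        quadruple (quad₃ K A) (quad₄ K A) (quad₁ K A) (quad₂ K A) G) := by
  have key (C D : A ⊗[K] A) (x y z w : A) : gammaMap H.S H.α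
      (pair (quad₂ K A) (quad₃ K A) C * pair (quad₁ K A) (quad₄ K A) D *
        (z ⊗ₜ w) ⊗ₜ (x ⊗ₜ y)) =
      (H.S w * evMap H.S H.α C * x) ⊗ₜ (H.S z * evMap H.S H.α D * y) := by
    induction C with
    | zero => simp
    | add s t hs ht => simp only [map_add, mul_add, add_mul, TensorProduct.add_tmul, hs, ht]
    | tmul c c' =>
      induction D with
      | zero => simp
      | add s t hs ht => simp only [map_add, mul_add, add_mul, TensorProduct.tmul_add, hs, ht]
      | tmul d d' => simp [gammaMap_tmul, evMap_tmul, H.S_mul, mul_assoc]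
  rw [val_braid, val_braid, ← pair_swap (quad₂ K A), ← pair_swap (quad₁ K A)]
  induction G using induction₄ with
  | zero => simp
  | add s t hs ht => simp only [map_add, mul_add, add_mul, hs, ht]
  | tmul x y z w =>
    have h1 : quadruple (quad₃ K A) (quad₄ K A) (quad₁ K A) (quad₂ K A)
        ((x ⊗ₜ y) ⊗ₜ (z ⊗ₜ w)) = (z ⊗ₜ w) ⊗ₜ (x ⊗ₜ y) := by simp
    have h2 : H.S H.α * H.drinfeldUnit = H.braidα := by
      rw [S_mul_drinfeldUnit, drinfeldUnit_mul_α]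
    have h3 (a b : A) : H.S (H.S a * H.α * b) * H.drinfeldUnit = H.S b * H.braidα * a := by
      rw [H.S_mul, H.S_mul, mul_assoc, mul_assoc, S_S, ← mul_assoc (H.S H.α), h2, mul_assoc]
    rw [h1, key, gammaMap_tmul, swap_tmul, H.SS_tmul, Algebra.TensorProduct.tmul_mul_tmul, h3, h3]
    rfl

theorem twist_mul_Δ_evMap (D : A ⊗[K] A) : H.twist * H.Δ (evMap H.S H.α D) =
    gammaMap H.S H.α (H.gammaWord * pair (conv H.Δ (quad₁ K A) (quad₂ K A))
      (conv H.Δ (quad₃ K A) (quad₄ K A)) D) := by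
  induction D with
  | zero => simp
  | add s t hs ht => simp only [map_add, mul_add, hs, ht]
  | tmul x y =>
    rw [evMap_tmul, map_mul, map_mul, ← mul_assoc, ← mul_assoc, ← H.prodS_mul_twist,
      mul_assoc (H.prodS x), H.twist_mul_Δ_α]
    exact H.gammaMap_mul _ _ _

/-- Written as values of `gammaMap`, the two sides are the two sides of `eval_braid`. -/
theorem twist_mul_Δ_braidα :
    H.twist * H.Δ H.braidα * ((H.Rswap * H.R : (A ⊗[K] A)ˣ) : A ⊗[K] A) =
      H.SS (swap K A H.γ) * ((H.drinfeldUnit : A) ⊗ₜ[K] (H.drinfeldUnit : A)) := by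
  have h1 (G : (A ⊗[K] A) ⊗[K] (A ⊗[K] A)) (D : A ⊗[K] A) : gammaMap H.S H.α G * D =
      gammaMap H.S H.α (G * pair (quad₃ K A) (quad₄ K A) D) := by
    have := H.gammaMap_mul 1 D G
    rwa [map_one, H.SS_one, one_mul, map_one, one_mul] at this
  have h2 : pair (quad₃ K A) (quad₄ K A) ((H.Rswap * H.R : (A ⊗[K] A)ˣ) : A ⊗[K] A) =
      ↑(H.braid (quad₄ K A) (quad₃ K A) * H.braid (quad₃ K A) (quad₄ K A)) := by
    rw [Units.val_mul, Units.val_mul, map_mul, val_braid, val_braid, ← pair_swap (quad₃ K A)]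
    rfl
  have hγ : H.γ = gammaMap H.S H.α H.gammaWord := rfl
  rw [braidα, twist_mul_Δ_evMap, h1, h2, pair_swap, hγ, SS_swap_gamma_mul, H.quadruple_gammaWord,
    ← quadruple_quad H.gammaWord, H.quadruple_gammaWord, ← val_braid, ← Units.val_mul,
    ← Units.val_mul, ← Units.val_mul, ← Units.val_mul]
  exact H.eval_braid _ _ _ _ H.leftEq_gammaMap₂₃ H.leftEq_gammaMap₁₄

theorem Δ_drinfeldUnit : H.Δ H.drinfeldUnit =
    ((H.twist⁻¹ : (A ⊗[K] A)ˣ) : A ⊗[K] A) * H.SS (swap K A H.twist) *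
      ((H.drinfeldUnit : A) ⊗ₜ[K] (H.drinfeldUnit : A)) *
        (((H.Rswap * H.R)⁻¹ : (A ⊗[K] A)ˣ) : A ⊗[K] A) := by
  set Z := H.Rswap * H.R with hZ
  set U := (H.drinfeldUnit : A) ⊗ₜ[K] (H.drinfeldUnit : A) with hU
  have hZΔ (y : A) : ((Z⁻¹ : (A ⊗[K] A)ˣ) : A ⊗[K] A) * H.Δ y =
      H.Δ y * ((Z⁻¹ : (A ⊗[K] A)ˣ) : A ⊗[K] A) := by
    rw [Units.inv_mul_eq_iff_eq_mul, ← mul_assoc, H.Rswap_mul_R_mul_Δ, Units.mul_inv_cancel_right]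
  -- A factor `Δ(y)` commutes with `(R'R)⁻¹`, crosses `u ⊗ u` as its image under `S² ⊗ S²`, and is
  -- absorbed into the twist as `F Δ(S y)`. This one rule gives both the intertwining property and
  -- the value at `S⁻¹(α)`.
  have hw (y : A) : ((H.twist⁻¹ : (A ⊗[K] A)ˣ) : A ⊗[K] A) * H.SS (swap K A H.twist) * U *
      ((Z⁻¹ : (A ⊗[K] A)ˣ) : A ⊗[K] A) * H.Δ y =
      ((H.twist⁻¹ : (A ⊗[K] A)ˣ) : A ⊗[K] A) * H.SS (swap K A (H.twist * H.Δ (H.S y))) * U *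
        ((Z⁻¹ : (A ⊗[K] A)ˣ) : A ⊗[K] A) := by
    rw [← H.prodS_mul_twist, map_mul, H.SS_mul, mul_assoc, hZΔ, ← mul_assoc, mul_assoc _ U,
      ← H.SS_SS_mul, ← mul_assoc, mul_assoc _ (H.SS (swap K A H.twist))]
    have h : swap K A (H.prodS y) = H.SS (H.Δ y) := by
      rw [H.prodS_apply]
      generalize H.Δ y = D
      induction D with
      | zero => simp
      | tmul a b => rfl
      | add s t hs ht => simp only [map_add, hs, ht]
    rw [h]
  -- Uniqueness of intertwiners over `Δ`: both sides intertwine, and they agree after right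
  -- multiplication by `Δ(S⁻¹(α))`.
  refine (H.braidData.map H.Δ).eq_of_mul_α_eq (H.copData.map H.Δ) (fun x => ?_) (fun x => ?_) ?_
  · change H.Δ (H.S x) * _ = _ * H.Δ (H.S.symm x)
    rw [← map_mul, ← map_mul, S_mul_drinfeldUnit]
  · change H.Δ (H.S x) * _ = _ * H.Δ (H.S.symm x)
    rw [hw, LinearEquiv.apply_symm_apply, map_mul, H.SS_mul, ← H.prodS_apply, ← mul_assoc,
      ← mul_assoc, ← mul_assoc, ← mul_assoc]
    congr 3
    rw [Units.eq_inv_mul_iff_mul_eq, ← mul_assoc, ← H.prodS_mul_twist, Units.mul_inv_cancel_right]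
  · change _ * H.Δ (H.S.symm H.α) = _ * H.Δ (H.S.symm H.α)
    rw [hw, LinearEquiv.apply_symm_apply, ← map_mul, drinfeldUnit_mul_α, H.twist_mul_Δ_α,
      Units.eq_mul_inv_iff_mul_eq, mul_assoc _ _ U, Units.eq_inv_mul_iff_mul_eq, ← mul_assoc,
      H.twist_mul_Δ_braidα]

end QuasitriangularQuasiHopfAlgebra

end

end QuasiHopf

end

theorem proposition2p2 {K : Type*} {A : Type*} [Field K] [Ring A] [Algebra K A]
    (H : QuasiHopf.QuasitriangularQuasiHopfAlgebra K A) :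
    ∃ (u : Aˣ) (F : (A ⊗[K] A)ˣ),
      (u : A) = H.drinfeldElement ∧
      (F : A ⊗[K] A) = H.F ∧
      H.ε u = 1 ∧
      (∀ a : A, H.S (H.S a) = u * a * (u⁻¹ : Aˣ)) ∧
      H.Δ u = ((F⁻¹ : (A ⊗[K] A)ˣ) : A ⊗[K] A) * H.SS (QuasiHopf.swap K A F) *
        ((u : A) ⊗ₜ[K] (u : A)) * (((H.Rswap * H.R)⁻¹ : (A ⊗[K] A)ˣ) : A ⊗[K] A) := by
  refine ⟨H.drinfeldUnit, H.twist, H.val_drinfeldUnit, H.val_twist, H.counit_drinfeldUnit,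
    fun a => ?_, H.Δ_drinfeldUnit⟩
  rw [← H.S_S, Units.mul_inv_cancel_right]
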